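/- Let $\Gamma$ be the metric graph associated with a finite connected multigraph $G$ (loops and multiple edges allowed) with positive edge lengths $\ell(e)$: each edge $e$ is realised as a segment of length $\ell(e)$ glued to its end vertices. A single point is allowed. Write $\ell(\Gamma)=\sum_e \ell(e)$, let $v(p)$ be the valence of $p\in\Gamma$ (the number of tangent directions at $p$), and let $q:\Gamma\to\mathbb Z_{\ge 0}$ be a function with finite support such that the canonical divisor $K=\sum_{p}(2q(p)+v(p)-2)[p]$ is effective; then $\overline{\Gamma}=(\Gamma,q)$ is called a polarized metric graph (pm-graph). Its genus is $g=\dim_{\mathbb R}H^1(\Gamma,\mathbb R)+\sum_p q(p)$. For a divisor $D=\sum_p n_p[p]$ and a function $f$ on $\Gamma$ write $f(D)=\sum_p n_p f(p)$. For a continuous $f:\Gamma\to\mathbb R$ that is $C^2$ outside some finite vertex set, with $f''$ square integrable, put $\Delta f=-f''\,dx-\sum_p\sigma_p(f)\,\delta_p$, where $\sigma_p(f)$ is the sum of the outward derivatives of $f$ over the tangent directions at $p$. The effective resistance is $r(y,z)=j(y)$, where $j$ is the solution of $\Delta j=\delta_y-\delta_z$ with $j(z)=0$, and $r(K,K)$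 is obtained by evaluating $r$ at $K$ in both variables. The Green's function of a Borel measure $\nu$ of total mass $1$ is the continuous symmetric function $g_\nu$ on $\Gamma\times\Gamma$ with $\Delta_x g_\nu(x,y)=\delta_y-\nu$ and $\int g_\nu(x,y)\,d\nu(x)=0$ for all $y$. Let $\mu$ be the admissible measure of $K$, that is, the Borel measure of total mass $1$ for which $g_\mu(x,x)+g_\mu(x,K)$ is independent of $x$. Define $$\epsilon(\overline{\Gamma})=\int r(K,y)\,d\mu(y),\qquad \tau(\overline{\Gamma})=\frac12\iint r(x,y)\,d\mu(x)\,d\mu(y),\qquad \varphi(\overline{\Gamma})=3g\,\tau(\overline{\Gamma})-\frac14\bigl(\epsilon(\overline{\Gamma})+\ell(\Gamma)\bigr).$$ If $g\ge 2$, then $$\tau(\overline{\Gamma})=\frac{2g-1}{4g(g-1)}\,\epsilon(\overline{\Gamma})-\frac{r(K,K)}{8g(g-1)},$$ and consequently $$\varphi(\overline{\Gamma})=\frac{5g-2}{4(g-1)}\,\epsilon(\overline{\Gamma})-\frac{3}{8(g-1)}\,r(K,K)-\frac14\,\ell(\Gamma).$$ -/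

import Mathlib

open MeasureTheory Set

noncomputable section

/-- A weighted graph: a finite connected multigraph (loops and multiple edges are allowed) with
positive edge lengths. Every edge carries an auxiliary orientation from `src e` to `tgt e`. -/
structure WeightedGraph (V E : Type*) [Fintype V] [Fintype E] where
  src : E → V
  tgt : E → V
  len : E → ℝ
  len_pos : ∀ e, 0 < len e
  nonempty : Nonempty V
  connected : ∀ v w : V, Relation.EqvGen (fun a b => ∃ e, src e = a ∧ tgt e = b) v w

/-- The points of the metric graph `Γ` obtained from `G` by gluing, for each edge `e`, a segment of
length `len e` to its end vertices: a point is a vertex, or lies in the interior of a unique edge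
at distance `t` from its source (measured along the edge). -/
inductive WeightedGraph.Point {V E : Type*} [Fintype V] [Fintype E] (G : WeightedGraph V E)
  | vertex (v : V) : G.Point
  | interior (e : E) (t : ℝ) (h₀ : 0 < t) (h₁ : t < G.len e) : G.Point

namespace WeightedGraph

variable {V E : Type*} [Fintype V] [Fintype E] (G : WeightedGraph V E)

/-- The arc length parametrization `[0, len e] → Γ` of the closed segment `e`, extended to `ℝ` by
the constant values `src e` on the left and `tgt e` on the right. -/
def edgePt (e : E) (t : ℝ) : G.Point :=
  if h₀ : 0 < t then
    if h₁ : t < G.len e then .interior e t h₀ h₁ else .vertex (G.tgt e)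
  else .vertex (G.src e)

/-- The topology of `Γ` as a CW-complex: the final (quotient) topology for the segments. (For the
graph with one vertex and no edge this is the topology of the one-point space.) -/
instance : TopologicalSpace G.Point :=
  ⨆ e : E, TopologicalSpace.coinduced (G.edgePt e) inferInstance

instance : MeasurableSpace G.Point := borel G.Point

instance : BorelSpace G.Point := ⟨rfl⟩

theorem continuous_edgePt (e : E) : Continuous (G.edgePt e) :=
  continuous_iff_coinduced_le.2 (le_iSup
    (fun e : E => TopologicalSpace.coinduced (G.edgePt e) inferInstance) e)

/-- The total length of the metric graph. -/
def totalLength : ℝ := ∑ e, G.len e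

open Classical in
/-- The valence of a point: the number of tangent directions at it. A loop at a vertex
contributes two directions. -/
def valence : G.Point → ℕ
  | .vertex v => (Finset.univ.filter fun e => G.src e = v).card
      + (Finset.univ.filter fun e => G.tgt e = v).card
  | .interior _ _ _ _ => 2

/-- The cellular coboundary operator `C⁰(Γ, ℝ) → C¹(Γ, ℝ)`. -/
def coboundary : (V → ℝ) →ₗ[ℝ] (E → ℝ) where
  toFun c e := c (G.tgt e) - c (G.src e)
  map_add' c d := by ext e; simp; ring
  map_smul' a c := by ext e; simp; ring

/-- The first Betti number `dim H¹(Γ, ℝ)`, by cellular cohomology. -/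
def betti : ℕ := Module.finrank ℝ ((E → ℝ) ⧸ LinearMap.range G.coboundary)

/-! ### The Laplacian -/

open Classical in
/-- `σ_p(f)`: the sum over all tangent directions at `p` of the outward pointing derivatives
of `f`. -/
def outwardDeriv (f : G.Point → ℝ) : G.Point → ℝ
  | .vertex v =>
      (∑ e with G.src e = v, derivWithin (f ∘ G.edgePt e) (Ici 0) 0)
        - ∑ e with G.tgt e = v, derivWithin (f ∘ G.edgePt e) (Iic (G.len e)) (G.len e)
  | .interior e t _ _ =>
      derivWithin (f ∘ G.edgePt e) (Ici t) t - derivWithin (f ∘ G.edgePt e) (Iic t) t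

/-- The second derivative of `f` along the edge `e`, in the arc length parameter. -/
def secondDeriv (f : G.Point → ℝ) (e : E) : ℝ → ℝ := deriv (deriv (f ∘ G.edgePt e))

/-- The domain of the Laplacian: continuous functions on `Γ` that are `C²` outside some vertex set,
that is, outside the vertices of `G` and a finite set `S`, and whose second derivative is square
integrable for the Lebesgue measure. -/
structure InDomain (f : G.Point → ℝ) : Prop where
  continuous : Continuous f
  contDiffOn : ∃ S : Set G.Point, S.Finite ∧
    ∀ e, ContDiffOn ℝ 2 (f ∘ G.edgePt e) {t | t ∈ Ioo 0 (G.len e) ∧ G.edgePt e t ∉ S}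
  memLp : ∀ e, MemLp (G.secondDeriv f e) 2 (volume.restrict (Ioo 0 (G.len e)))

/-- The point mass at `p`, as a signed Borel measure on `Γ`. -/
def pointMass (p : G.Point) : SignedMeasure G.Point := (Measure.dirac p).toSignedMeasure

/-- The Laplacian `Δ f = - f'' dx - ∑_p σ_p(f) δ_p`, a signed Borel measure on `Γ`; it is
meaningful for `f` in the domain `InDomain`, for which the sum over `p` has finite support. -/
def laplacian (f : G.Point → ℝ) : SignedMeasure G.Point :=
  - (∑ e, ((volume.restrict (Ioo 0 (G.len e))).withDensityᵥ (G.secondDeriv f e)).map (G.edgePt e))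
    - ∑ᶠ p, G.outwardDeriv f p • G.pointMass p

/-! ### Effective resistance, Green's functions and admissible measures -/

/-- The fundamental solution `x ↦ j_z(x, y)`: the function `f` on `Γ` such that
`Δ f = δ_y - δ_z` and `f z = 0`. -/
def fundamentalSolution (z y : G.Point) : G.Point → ℝ :=
  Classical.epsilon fun f : G.Point → ℝ =>
    G.InDomain f ∧ G.laplacian f = G.pointMass y - G.pointMass z ∧ f z = 0

/-- The effective resistance `r(y, z) = j_z(y, y)`. -/
def resistance (y z : G.Point) : ℝ := G.fundamentalSolution z y y

/-- `g` is the Green's function of the measure `ν`. -/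
structure IsGreen (ν : Measure G.Point) [IsFiniteMeasure ν] (g : G.Point → G.Point → ℝ) :
    Prop where
  continuous : Continuous fun x : G.Point × G.Point => g x.1 x.2
  symm : ∀ x y, g x y = g y x
  inDomain : ∀ y, G.InDomain fun x => g x y
  laplacian_eq : ∀ y, G.laplacian (fun x => g x y) = G.pointMass y - ν.toSignedMeasure
  integral_eq : ∀ y, ∫ x, g x y ∂ν = 0

/-- The value `f(D) = ∑_p n_p f(p)` of a function at a divisor `D = ∑_p n_p [p]` on `Γ`. -/
def evalDiv (f : G.Point → ℝ) (D : G.Point →₀ ℤ) : ℝ := D.sum fun p n => (n : ℝ) * f p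

/-- `μ` is an admissible measure for the divisor `D`: a Borel measure of total mass `1` whose
Green's function `g` makes `g(x, x) + g(x, D)` constant. -/
def IsAdmissible (D : G.Point →₀ ℤ) (μ : Measure G.Point) : Prop :=
  ∃ (_ : IsProbabilityMeasure μ) (g : G.Point → G.Point → ℝ) (a : ℝ),
    G.IsGreen μ g ∧ ∀ x, g x x + G.evalDiv (g x) D = a

/-- The admissible measure for the divisor `D`. -/
def admissibleMeasure (D : G.Point →₀ ℤ) : Measure G.Point :=
  Classical.epsilon (G.IsAdmissible D)

/-- The divisor `∑_p (2 q(p) + v(p) - 2) [p]`. -/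
def canonicalDivisor (q : G.Point →₀ ℤ) : G.Point →₀ ℤ :=
  Finsupp.ofSupportFinite (fun p => 2 * q p + G.valence p - 2) <| by
    refine (q.support.finite_toSet.union (finite_range Point.vertex)).subset ?_
    rintro (v | ⟨e, t, h₀, h₁⟩) hp
    · exact Or.inr ⟨v, rfl⟩
    · refine Or.inl ?_
      simpa [valence] using hp

end WeightedGraph

/-- A polarized metric graph, presented by a weighted graph whose associated metric graph is `Γ`:
a finitely supported nonnegative weight function `q : Γ → ℤ` for which the canonical divisor is
effective. The support of `q` need not consist of vertices of the presentation. -/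
structure PMGraph (V E : Type*) [Fintype V] [Fintype E] extends WeightedGraph V E where
  q : toWeightedGraph.Point →₀ ℤ
  q_nonneg : ∀ p, 0 ≤ q p
  effective : ∀ p, 0 ≤ toWeightedGraph.canonicalDivisor q p

namespace PMGraph

variable {V E : Type*} [Fintype V] [Fintype E] (Γ : PMGraph V E)

/-- The canonical divisor `K`. -/
def K : Γ.Point →₀ ℤ := Γ.canonicalDivisor Γ.q

/-- The genus `dim H¹(Γ, ℝ) + ∑_p q(p)`. -/
def genus : ℤ := (Γ.betti : ℤ) + Γ.q.sum fun _ n => n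

/-- The admissible measure `μ` for the canonical divisor. -/
def mu : Measure Γ.Point := Γ.admissibleMeasure Γ.K

/-- `r(K, K)`. -/
def resistanceKK : ℝ := Γ.evalDiv (fun x => Γ.evalDiv (fun y => Γ.resistance x y) Γ.K) Γ.K

/-- `ε(Γ) = ∬ r(x, y) δ_K(x) dμ(y)`. -/
def epsilon : ℝ := ∫ y, Γ.evalDiv (fun x => Γ.resistance x y) Γ.K ∂Γ.mu

/-- `τ(Γ) = ½ ∬ r(x, y) dμ(x) dμ(y)`. -/
def tau : ℝ := (1 / 2) * ∫ y, ∫ x, Γ.resistance x y ∂Γ.mu ∂Γ.mu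

/-- `φ(Γ) = 3 g τ(Γ) - ¼ (ε(Γ) + ℓ(Γ))`. -/
def phi : ℝ := 3 * (Γ.genus : ℝ) * Γ.tau - (1 / 4) * (Γ.epsilon + Γ.totalLength)

end PMGraph

end

noncomputable section

/-! ### Piecewise `C²` functions on an interval -/

/-! The identities come from the admissible Green's function g = g_μ through r(x,y) = g(x,x) -
2g(x,y) + g(y,y). Integrating g(x,x) + g(x,K) = a against μ kills the second term, so ∫ g(x,x) dμ =
a, and therefore τ = a. Let γ be the genus, d = 2γ - 2 = deg K, A = ∑ K(p) g(p,p) and B = g(K,K).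
Evaluating the admissibility condition at K gives A + B = dτ, while expanding r gives ε = A + dτ and
r(K,K) = 2dA - 2B. Eliminating A and B leaves r(K,K) = (4γ - 2)ε - 8γ(γ - 1)τ, which is the formula
for τ; the one for φ follows by substitution.

The analytic work shows that r and μ, which are defined by choice, really have these properties. Fix
a vertex z. The inverse J of the Laplace matrix grounded at z, interpolated along the edges and
corrected by the Dirichlet Green's function of each edge (`bubble`), is a continuous symmetric
kernel k with Δ_x k(x,y) = δ_y - δ_z. The representation formula f(y) - f(z) = ∫ k(x,y) dΔf(x) holds
on the whole domain of the Laplacian (`IsPotential.sub_eq_integral_laplacian`). So Δf determines f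
up to a constant, which computes r and every Green's function in terms of k.

The admissible measure is explicit (`exists_isAdmissible`): γμ = ∑ ρ_e dx + ∑ q(p) δ_p, with ρ_e =
(ℓ(e) - R_e)/ℓ(e)² and R_e the resistance in Γ between the ends of e. It is positive because R_e ≤
ℓ(e) (`IsPotential.resistance_le`). -/

theorem exists_affine_of_hasDerivAt_zero {χ ψ : ℝ → ℝ} {a b : ℝ} (hab : a < b)
    (hc : ContinuousOn χ (Icc a b)) (h1 : ∀ s ∈ Ioo a b, HasDerivAt χ (ψ s) s)
    (h2 : ∀ s ∈ Ioo a b, HasDerivAt ψ 0 s) :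
    ∃ β, ∀ s ∈ Icc a b, χ s = χ a + β * (s - a) := by
  have hconst : ∀ x ∈ Ioo a b, ∀ y ∈ Ioo a b, x < y → ψ x = ψ y := by
    intro x hx y hy hxy
    have hsub : Icc x y ⊆ Ioo a b := fun z hz => ⟨hx.1.trans_le hz.1, hz.2.trans_lt hy.2⟩
    obtain ⟨c, -, h⟩ := exists_hasDerivAt_eq_slope ψ (fun _ => 0) hxy
      (fun z hz => (h2 z (hsub hz)).continuousAt.continuousWithinAt)
      (fun z hz => h2 z (hsub (Ioo_subset_Icc_self hz)))
    have h0 : y - x ≠ 0 := (sub_pos.2 hxy).ne'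
    field_simp at h
    linarith
  have hm : (a + b) / 2 ∈ Ioo a b := ⟨by linarith, by linarith⟩
  refine ⟨ψ ((a + b) / 2), fun s hs => ?_⟩
  rcases hs.1.eq_or_lt with rfl | has
  · simp
  obtain ⟨c, hcm, h⟩ := exists_hasDerivAt_eq_slope χ ψ has
    (hc.mono (Icc_subset_Icc_right hs.2)) (fun z hz => h1 z ⟨hz.1, hz.2.trans_le hs.2⟩)
  have hcb : c ∈ Ioo a b := ⟨hcm.1, hcm.2.trans_le hs.2⟩
  have hψ : ψ ((a + b) / 2) = ψ c := by
    rcases lt_trichotomy c ((a + b) / 2) with h | h | h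
    · exact (hconst _ hcb _ hm h).symm
    · rw [h]
    · exact hconst _ hm _ hcb h
  have h0 : s - a ≠ 0 := (sub_pos.2 has).ne'
  rw [hψ, h]
  field_simp
  ring

/-- The piecewise linear function with slope change `k p` at `p`, vanishing on the left. -/
def kinkSum (k : ℝ →₀ ℝ) (t : ℝ) : ℝ := k.sum fun p m => m * max (t - p) 0

theorem kinkSum_add (k l : ℝ →₀ ℝ) (t : ℝ) : kinkSum (k + l) t = kinkSum k t + kinkSum l t :=
  Finsupp.sum_add_index' (by simp) (by intros; ring)

theorem kinkSum_smul (c : ℝ) (k : ℝ →₀ ℝ) (t : ℝ) : kinkSum (c • k) t = c * kinkSum k t := by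
  unfold kinkSum
  rw [Finsupp.sum_smul_index' (by simp), Finsupp.mul_sum]
  simp only [smul_eq_mul, mul_assoc]

theorem kinkSum_single (p m t : ℝ) : kinkSum (Finsupp.single p m) t = m * max (t - p) 0 :=
  Finsupp.sum_single_index (by simp)

@[simp] theorem kinkSum_zero (t : ℝ) : kinkSum 0 t = 0 := Finsupp.sum_zero_index

/-- Induction on the largest exceptional point p: to its left the induction hypothesis applies on
[0, p], to its right χ is affine, and by continuity the two pieces differ only by a kink at p.
Exceptional points outside (0, L) are discarded. -/
theorem exists_kinkSum (T : Finset ℝ) {χ ψ : ℝ → ℝ} {L : ℝ} (hL : 0 < L)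
    (hc : ContinuousOn χ (Icc 0 L)) (h1 : ∀ s ∈ Ioo 0 L, s ∉ T → HasDerivAt χ (ψ s) s)
    (h2 : ∀ s ∈ Ioo 0 L, s ∉ T → HasDerivAt ψ 0 s) :
    ∃ (b : ℝ) (k : ℝ →₀ ℝ), (∀ p, k p ≠ 0 → p ∈ Ioo 0 L) ∧
      ∀ s ∈ Icc 0 L, χ s = χ 0 + b * s + kinkSum k s := by
  induction T using Finset.induction_on_max generalizing L with
  | empty =>
    obtain ⟨β, hβ⟩ := exists_affine_of_hasDerivAt_zero hL hc (fun s hs => h1 s hs (by simp))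
      (fun s hs => h2 s hs (by simp))
    exact ⟨β, 0, by simp, fun s hs => by rw [hβ s hs]; simp⟩
  | insert p T hmax ih =>
    by_cases hp : p ∈ Ioo 0 L
    · obtain ⟨b, k, hk, hχ⟩ := ih hp.1 (hc.mono (Icc_subset_Icc_right hp.2.le))
        (fun s hs hT => h1 s ⟨hs.1, hs.2.trans hp.2⟩ (by simp [hT, hs.2.ne]))
        (fun s hs hT => h2 s ⟨hs.1, hs.2.trans hp.2⟩ (by simp [hT, hs.2.ne]))
      have hT : ∀ s ∈ Ioo p L, s ∉ insert p T := fun s hs => by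
        simp only [Finset.mem_insert, not_or]
        exact ⟨hs.1.ne', fun h => (hmax s h).not_gt hs.1⟩
      obtain ⟨β, hβ⟩ := exists_affine_of_hasDerivAt_zero hp.2
        (hc.mono (Icc_subset_Icc_left hp.1.le))
        (fun s hs => h1 s ⟨hp.1.trans hs.1, hs.2⟩ (hT s hs))
        (fun s hs => h2 s ⟨hp.1.trans hs.1, hs.2⟩ (hT s hs))
      -- All kinks found so far lie before p, so to the right of p their sum is affine, with slope
      -- the total of the coefficients.
      have hlin : ∀ s, p ≤ s → kinkSum k s = kinkSum k p + (k.sum fun _ m => m) * (s - p) := by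
        intro s hs
        unfold kinkSum
        rw [Finsupp.sum_mul, ← Finsupp.sum_add]
        refine Finset.sum_congr rfl fun q hq => ?_
        have hq' := (hk q (Finsupp.mem_support_iff.1 hq)).2
        beta_reduce
        rw [max_eq_left (by linarith), max_eq_left (by linarith)]
        ring
      -- The new coefficient is the jump of slope at p: β on the right, b plus the earlier kinks on
      -- the left.
      refine ⟨b, k + Finsupp.single p (β - b - k.sum fun _ m => m), fun q hq => ?_,
        fun s hs => ?_⟩
      · by_cases hqp : q = p
        · exact hqp ▸ hp
        · rw [Finsupp.add_apply, Finsupp.single_eq_of_ne hqp, add_zero] at hq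
          exact ⟨(hk q hq).1, (hk q hq).2.trans hp.2⟩
      · rw [kinkSum_add, kinkSum_single]
        rcases le_total s p with h | h
        · rw [max_eq_right (by linarith), hχ s ⟨hs.1, h⟩]
          ring
        · rw [max_eq_left (by linarith), hβ s ⟨h, hs.2⟩, hχ p ⟨hp.1.le, le_rfl⟩, hlin s h]
          ring
    · refine ih hL hc (fun s hs hT => h1 s hs ?_) (fun s hs hT => h2 s hs ?_)
      all_goals
        simp only [Finset.mem_insert, not_or]
        exact ⟨fun h => hp (h ▸ hs), hT⟩

/-- On `[0, L]` the function `φ` has initial slope `b`, the second derivative `w`, and slope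
changes `k`. -/
structure KinkExpansion (φ : ℝ → ℝ) (L : ℝ) (w : ℝ → ℝ) (b : ℝ) (k : ℝ →₀ ℝ) : Prop where
  mem_Ioo : ∀ p, k p ≠ 0 → p ∈ Ioo 0 L
  integrable : Integrable w
  eq : ∀ t ∈ Icc 0 L, φ t = φ 0 + b * t + (∫ x in (0 : ℝ)..t, ∫ y in (0 : ℝ)..x, w y) + kinkSum k t

theorem hasDerivAt_primitive₂ {w : ℝ → ℝ} (hw : Integrable w) (t : ℝ) :
    HasDerivAt (fun t => ∫ x in (0 : ℝ)..t, ∫ y in (0 : ℝ)..x, w y) (∫ y in (0 : ℝ)..t, w y) t := by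
  have hc : Continuous fun x => ∫ y in (0 : ℝ)..x, w y :=
    intervalIntegral.continuous_primitive (fun a b => hw.intervalIntegrable) 0
  exact intervalIntegral.integral_hasDerivAt_right (hc.intervalIntegrable _ _)
    (hc.stronglyMeasurableAtFilter _ _) hc.continuousAt

/-- Subtracting the double primitive of the second derivative leaves a continuous function whose
second derivative vanishes off `T`, hence a piecewise affine one. -/
theorem exists_kinkExpansion {φ : ℝ → ℝ} {L : ℝ} (hL : 0 < L) (hφ : Continuous φ) (T : Finset ℝ)
    (hC : ContDiffOn ℝ 2 φ {t | t ∈ Ioo 0 L ∧ t ∉ T})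
    (hw : IntegrableOn (deriv (deriv φ)) (Ioo 0 L)) :
    ∃ b k, KinkExpansion φ L ((Ioo 0 L).indicator (deriv (deriv φ))) b k := by
  set w := (Ioo 0 L).indicator (deriv (deriv φ)) with hwdef
  have hwi : Integrable w := hw.integrable_indicator measurableSet_Ioo
  have hopen : IsOpen {t | t ∈ Ioo 0 L ∧ t ∉ T} := isOpen_Ioo.sdiff T.finite_toSet.isClosed
  have hW := hasDerivAt_primitive₂ hwi
  have hcd : ContDiffOn ℝ 1 (deriv φ) {t | t ∈ Ioo 0 L ∧ t ∉ T} :=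
    ((contDiffOn_succ_iff_deriv_of_isOpen (n := 1) hopen).1 (by rwa [one_add_one_eq_two])).2.2
  have hcd2 : ContinuousOn (deriv (deriv φ)) {t | t ∈ Ioo 0 L ∧ t ∉ T} :=
    hcd.continuousOn_deriv_of_isOpen hopen le_rfl
  have hP : ∀ s ∈ Ioo 0 L, s ∉ T →
      HasDerivAt (fun t => ∫ y in (0 : ℝ)..t, w y) (deriv (deriv φ) s) s := by
    intro s hs hT
    have hev : w =ᶠ[nhds s] deriv (deriv φ) := by
      filter_upwards [isOpen_Ioo.mem_nhds hs] with t ht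
      exact indicator_of_mem ht _
    have hca : ContinuousAt (deriv (deriv φ)) s := hcd2.continuousAt (hopen.mem_nhds ⟨hs, hT⟩)
    have := intervalIntegral.integral_hasDerivAt_right (a := 0) (b := s)
      hwi.intervalIntegrable hwi.aestronglyMeasurable.stronglyMeasurableAtFilter
      (hca.congr hev.symm)
    rwa [hev.eq_of_nhds] at this
  obtain ⟨b, k, hk, h⟩ := exists_kinkSum T (χ := fun t => φ t - ∫ x in (0 : ℝ)..t,
      ∫ y in (0 : ℝ)..x, w y) (ψ := fun t => deriv φ t - ∫ y in (0 : ℝ)..t, w y) hL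
    (fun s _ => (hφ.continuousAt.sub (hW s).continuousAt).continuousWithinAt)
    (fun s hs hT => (((hC.differentiableOn (by norm_num)).differentiableAt
      (hopen.mem_nhds ⟨hs, hT⟩)).hasDerivAt.sub (hW s)))
    (fun s hs hT => by
      exact ((((hcd.differentiableOn (by norm_num)).differentiableAt
        (hopen.mem_nhds ⟨hs, hT⟩)).hasDerivAt.sub (hP s hs hT))).congr_deriv (sub_self _))
  refine ⟨b, k, hk, hwi, fun t ht => ?_⟩
  have := h t ht
  simp only [intervalIntegral.integral_same, sub_zero] at this
  linarith

/-- A kink located exactly at t contributes to the right derivative but not to the left one; hence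
`≤` here and `<` in the companion statement. -/
theorem hasDerivWithinAt_kinkSum_Ici (k : ℝ →₀ ℝ) (t : ℝ) :
    HasDerivWithinAt (kinkSum k) (k.sum fun p m => if p ≤ t then m else 0) (Ici t) t := by
  unfold kinkSum Finsupp.sum
  refine HasDerivWithinAt.fun_sum fun p _ => ?_
  beta_reduce
  split_ifs with h
  · have : HasDerivAt (fun s => k p * (s - p)) (k p) t := by
      simpa using ((hasDerivAt_id t).sub_const p).const_mul (k p)
    refine this.hasDerivWithinAt.congr (fun s hs => ?_) ?_
    · rw [max_eq_left (by linarith [mem_Ici.1 hs])]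
    · rw [max_eq_left (by linarith)]
  · refine HasDerivAt.hasDerivWithinAt ((hasDerivAt_const t (0 : ℝ)).congr_of_eventuallyEq ?_)
    filter_upwards [Iio_mem_nhds (not_le.1 h)] with s hs
    rw [max_eq_right (by linarith [mem_Iio.1 hs]), mul_zero]

theorem hasDerivWithinAt_kinkSum_Iic (k : ℝ →₀ ℝ) (t : ℝ) :
    HasDerivWithinAt (kinkSum k) (k.sum fun p m => if p < t then m else 0) (Iic t) t := by
  unfold kinkSum Finsupp.sum
  refine HasDerivWithinAt.fun_sum fun p _ => ?_
  beta_reduce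
  split_ifs with h
  · have : HasDerivAt (fun s => k p * (s - p)) (k p) t := by
      simpa using ((hasDerivAt_id t).sub_const p).const_mul (k p)
    refine HasDerivAt.hasDerivWithinAt (this.congr_of_eventuallyEq ?_)
    filter_upwards [Ioi_mem_nhds h] with s hs
    rw [max_eq_left (by linarith [mem_Ioi.1 hs])]
  · refine ((hasDerivAt_const t (0 : ℝ)).hasDerivWithinAt).congr (fun s hs => ?_) ?_
    · rw [max_eq_right (by linarith [mem_Iic.1 hs, not_lt.1 h]), mul_zero]
    · rw [max_eq_right (by linarith [not_lt.1 h]), mul_zero]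

namespace KinkExpansion

variable {φ : ℝ → ℝ} {L : ℝ} {w : ℝ → ℝ} {b : ℝ} {k : ℝ →₀ ℝ}

theorem derivWithin_Ici (h : KinkExpansion φ L w b k) {t : ℝ} (ht : t ∈ Ico 0 L) :
    derivWithin φ (Ici t) t =
      b + (∫ y in (0 : ℝ)..t, w y) + k.sum fun p m => if p ≤ t then m else 0 := by
  refine HasDerivWithinAt.derivWithin ?_ (uniqueDiffWithinAt_Ici t)
  have h1 : HasDerivAt (fun t => φ 0 + b * t + ∫ x in (0 : ℝ)..t, ∫ y in (0 : ℝ)..x, w y)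
      (b + ∫ y in (0 : ℝ)..t, w y) t := by
    refine HasDerivAt.add ?_ (hasDerivAt_primitive₂ h.integrable t)
    simpa using ((hasDerivAt_id t).const_mul b).const_add (φ 0)
  refine (h1.hasDerivWithinAt.add (hasDerivWithinAt_kinkSum_Ici k t)).congr_of_eventuallyEq ?_
    (h.eq t ⟨ht.1, ht.2.le⟩)
  filter_upwards [self_mem_nhdsWithin, mem_nhdsWithin_of_mem_nhds (Iio_mem_nhds ht.2)] with s hs hs'
  exact h.eq s ⟨ht.1.trans hs, le_of_lt hs'⟩

theorem derivWithin_Iic (h : KinkExpansion φ L w b k) {t : ℝ} (ht : t ∈ Ioc 0 L) :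
    derivWithin φ (Iic t) t =
      b + (∫ y in (0 : ℝ)..t, w y) + k.sum fun p m => if p < t then m else 0 := by
  refine HasDerivWithinAt.derivWithin ?_ (uniqueDiffWithinAt_Iic t)
  have h1 : HasDerivAt (fun t => φ 0 + b * t + ∫ x in (0 : ℝ)..t, ∫ y in (0 : ℝ)..x, w y)
      (b + ∫ y in (0 : ℝ)..t, w y) t := by
    refine HasDerivAt.add ?_ (hasDerivAt_primitive₂ h.integrable t)
    simpa using ((hasDerivAt_id t).const_mul b).const_add (φ 0)
  refine (h1.hasDerivWithinAt.add (hasDerivWithinAt_kinkSum_Iic k t)).congr_of_eventuallyEq ?_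
    (h.eq t ⟨ht.1.le, ht.2⟩)
  filter_upwards [self_mem_nhdsWithin, mem_nhdsWithin_of_mem_nhds (Ioi_mem_nhds ht.1)] with s hs hs'
  exact h.eq s ⟨le_of_lt hs', le_trans hs ht.2⟩

theorem derivWithin_sub (h : KinkExpansion φ L w b k) {t : ℝ} (ht : t ∈ Ioo 0 L) :
    derivWithin φ (Ici t) t - derivWithin φ (Iic t) t = k t := by
  rw [h.derivWithin_Ici ⟨ht.1.le, ht.2⟩, h.derivWithin_Iic ⟨ht.1, ht.2.le⟩, add_sub_add_left_eq_sub,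
    ← Finsupp.sum_sub]
  have : ∀ p m : ℝ, ((if p ≤ t then m else 0) - if p < t then m else 0) = if p = t then m else 0 := by
    intro p m
    rcases lt_trichotomy p t with h | h | h
    · simp [h, h.le, h.ne]
    · simp [h]
    · simp [h.not_ge, h.not_gt, h.ne']
  simp only [this]
  unfold Finsupp.sum
  simp [Finset.sum_ite_eq']
  tauto

theorem derivWithin_zero (h : KinkExpansion φ L w b k) (hL : 0 < L) :
    derivWithin φ (Ici 0) 0 = b := by
  rw [h.derivWithin_Ici ⟨le_rfl, hL⟩, intervalIntegral.integral_same, add_zero]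
  rw [show (k.sum fun p m => if p ≤ 0 then m else 0) = 0 from
    Finset.sum_eq_zero fun p hp => if_neg (not_le.2 (h.mem_Ioo p (Finsupp.mem_support_iff.1 hp)).1)]
  simp

theorem derivWithin_length (h : KinkExpansion φ L w b k) (hL : 0 < L) :
    derivWithin φ (Iic L) L = b + (∫ y in (0 : ℝ)..L, w y) + k.sum fun _ m => m := by
  rw [h.derivWithin_Iic ⟨hL, le_rfl⟩]
  congr 1
  exact Finset.sum_congr rfl fun p hp => if_pos (h.mem_Ioo p (Finsupp.mem_support_iff.1 hp)).2

end KinkExpansion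

/-! ### Integration by parts on an edge -/

theorem integral_sub_mul_eq_primitive₂ {w : ℝ → ℝ} (hw : Integrable w) {s : ℝ} (hs : 0 ≤ s) :
    ∫ t in (0 : ℝ)..s, (s - t) * w t = ∫ x in (0 : ℝ)..s, ∫ y in (0 : ℝ)..x, w y := by
  set μ := (volume : Measure ℝ).restrict (Ioc 0 s)
  -- Fubini on the triangle y ≤ x inside (0, s]².
  have hint : Integrable (Function.uncurry fun x y : ℝ => (Iic x).indicator w y) (μ.prod μ) := by
    have h1 : Integrable (fun z : ℝ × ℝ => w z.2) (μ.prod μ) := hw.restrict.comp_snd μ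
    have : (Function.uncurry fun x y : ℝ => (Iic x).indicator w y) =
        {z : ℝ × ℝ | z.2 ≤ z.1}.indicator fun z => w z.2 := by
      ext ⟨x, y⟩
      simp [indicator]
    rw [this]
    exact h1.indicator (measurableSet_le measurable_snd measurable_fst)
  rw [intervalIntegral.integral_of_le hs, intervalIntegral.integral_of_le hs]
  have h2 := integral_integral_swap hint
  have hl : ∫ x, ∫ y, (Iic x).indicator w y ∂μ ∂μ = ∫ x in Ioc 0 s, ∫ y in (0 : ℝ)..x, w y := by
    refine setIntegral_congr_fun measurableSet_Ioc fun x hx => ?_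
    simp only [μ]
    rw [intervalIntegral.integral_of_le hx.1.le, integral_indicator measurableSet_Iic,
      Measure.restrict_restrict measurableSet_Iic]
    congr 2
    ext y
    simp only [mem_inter_iff, mem_Iic, mem_Ioc]
    exact ⟨fun h => ⟨h.2.1, h.1⟩, fun h => ⟨h.2, h.1, h.2.trans hx.2⟩⟩
  have hr : ∫ y, ∫ x, (Iic x).indicator w y ∂μ ∂μ = ∫ t in Ioc 0 s, (s - t) * w t := by
    refine setIntegral_congr_fun measurableSet_Ioc fun y hy => ?_
    simp only [μ]
    have : (fun x => (Iic x).indicator w y) = (Ici y).indicator fun _ => w y := by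
      ext x
      simp [indicator]
    rw [this, integral_indicator measurableSet_Ici, Measure.restrict_restrict measurableSet_Ici,
      show Ici y ∩ Ioc 0 s = Icc y s by
        ext x
        simp only [mem_inter_iff, mem_Ici, mem_Ioc, mem_Icc]
        exact ⟨fun h => ⟨h.1, h.2.2⟩, fun h => ⟨h.1, hy.1.trans_le h.1, h.2⟩⟩]
    simp [hy.2]
  rw [← hl, ← hr, h2]

/-- The pairing of a test function `H` on `[0, L]` with the distributional second derivative of
an extension by constants of a function with the given expansion. -/
def edgePairing (L : ℝ) (w : ℝ → ℝ) (b : ℝ) (k : ℝ →₀ ℝ) (H : ℝ → ℝ) : ℝ :=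
  (∫ t in (0 : ℝ)..L, H t * w t) + b * H 0
    - (b + (∫ t in (0 : ℝ)..L, w t) + k.sum fun _ m => m) * H L + k.sum fun p m => m * H p

/-- Two integrations by parts: the test function is affine except for a corner at s, so its second
derivative is -D δ_s and only values of φ survive. The restriction of the fundamental kernel to an
edge has exactly this shape. -/
theorem KinkExpansion.edgePairing_eq {φ : ℝ → ℝ} {L : ℝ} {w : ℝ → ℝ} {b : ℝ} {k : ℝ →₀ ℝ}
    (h : KinkExpansion φ L w b k) (A c D : ℝ) {s : ℝ} (hs : s ∈ Icc 0 L) :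
    edgePairing L w b k (fun t => A + c * t - D * max (s - t) 0) =
      -c * (φ L - φ 0) - D * (φ s - φ 0) := by
  have hL : 0 ≤ L := hs.1.trans hs.2
  have hw : ∀ {a b : ℝ}, IntervalIntegrable w volume a b := h.integrable.intervalIntegrable
  have hcl : ∀ (r a b : ℝ), IntervalIntegrable (fun t => (r - t) * w t) volume a b := fun r a b =>
    hw.continuousOn_mul (by fun_prop)
  have hcm : ∀ a b : ℝ, IntervalIntegrable (fun t => max (s - t) 0 * w t) volume a b := fun a b =>
    hw.continuousOn_mul (by fun_prop)
  have hmax : ∫ t in (0 : ℝ)..L, max (s - t) 0 * w t =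
      ∫ x in (0 : ℝ)..s, ∫ y in (0 : ℝ)..x, w y := by
    rw [← intervalIntegral.integral_add_adjacent_intervals (hcm 0 s) (hcm s L),
      ← integral_sub_mul_eq_primitive₂ h.integrable hs.1]
    have h1 : ∫ t in s..L, max (s - t) 0 * w t = 0 := by
      rw [intervalIntegral.integral_congr (g := fun _ => (0 : ℝ))]
      · simp
      · intro t ht
        rw [uIcc_of_le hs.2] at ht
        simp [max_eq_right (sub_nonpos.2 ht.1)]
    rw [h1, add_zero]
    refine intervalIntegral.integral_congr fun t ht => ?_
    rw [uIcc_of_le hs.1] at ht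
    simp [max_eq_left (sub_nonneg.2 ht.2)]
  have hI : ∫ t in (0 : ℝ)..L, (A + c * t - D * max (s - t) 0) * w t =
      (A + c * L) * (∫ t in (0 : ℝ)..L, w t) - c * (∫ x in (0 : ℝ)..L, ∫ y in (0 : ℝ)..x, w y)
        - D * ∫ x in (0 : ℝ)..s, ∫ y in (0 : ℝ)..x, w y := by
    rw [← hmax, ← integral_sub_mul_eq_primitive₂ h.integrable hL,
      ← intervalIntegral.integral_const_mul, ← intervalIntegral.integral_const_mul,
      ← intervalIntegral.integral_const_mul,
      ← intervalIntegral.integral_sub (hw.const_mul _) ((hcl _ _ _).const_mul _),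
      ← intervalIntegral.integral_sub ((hw.const_mul _).sub ((hcl _ _ _).const_mul _))
        ((hcm _ _).const_mul _)]
    refine intervalIntegral.integral_congr fun t _ => ?_
    ring
  have hkL : kinkSum k L = k.sum fun p m => m * (L - p) :=
    Finset.sum_congr rfl fun p hp => by
      beta_reduce
      rw [max_eq_left (sub_nonneg.2 (h.mem_Ioo p (Finsupp.mem_support_iff.1 hp)).2.le)]
  have hK : (k.sum fun p m => m * (A + c * p - D * max (s - p) 0)) =
      (A + c * L) * (k.sum fun _ m => m) - c * kinkSum k L - D * kinkSum k s := by
    rw [hkL]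
    unfold kinkSum
    rw [Finsupp.mul_sum, Finsupp.mul_sum, Finsupp.mul_sum, ← Finsupp.sum_sub, ← Finsupp.sum_sub]
    exact Finset.sum_congr rfl fun p _ => by ring
  have e1 := h.eq L ⟨hL, le_rfl⟩
  have e2 := h.eq s hs
  simp only [edgePairing, hI, hK, sub_zero, max_eq_left hs.1, max_eq_right (sub_nonpos.2 hs.2)]
  rw [e1, e2]
  ring


/-! ### Integration against signed measures -/

/-- Makes bounded measurable functions integrable against every signed measure, which additivity of
the integral in the measure requires. -/
instance MeasureTheory.SignedMeasure.isFiniteMeasure_variation {X : Type*} [MeasurableSpace X]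
    (s : SignedMeasure X) : IsFiniteMeasure s.variation := by
  rw [← SignedMeasure.totalVariation_eq_variation, SignedMeasure.totalVariation]
  infer_instance

/-- Split the density into positive and negative parts, each of which defines an ordinary finite
measure. -/
theorem integral_withDensityᵥ {X : Type*} [MeasurableSpace X] {μ : Measure X} {w h : X → ℝ}
    (hw : Integrable w μ) (hm : Measurable h) {C : ℝ} (hC : ∀ x, |h x| ≤ C) :
    ∫ᵛ x, h x ∂<•μ.withDensityᵥ w = ∫ x, h x * w x ∂μ := by
  have := isFiniteMeasure_withDensity_ofReal hw.2
  have := isFiniteMeasure_withDensity_ofReal hw.neg.2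
  have hi : ∀ s : SignedMeasure X, Integrable h s.variation := fun s =>
    Integrable.of_bound hm.aestronglyMeasurable C (Filter.Eventually.of_forall hC)
  have hneg : AEMeasurable (fun x => ENNReal.ofReal (-w x)) μ := hw.1.aemeasurable.neg.ennreal_ofReal
  have hp : ∀ v : X → ℝ, Integrable v μ → Integrable (fun x => h x * v x) μ := fun v hv =>
    hv.bdd_mul hm.aestronglyMeasurable (Filter.Eventually.of_forall hC)
  rw [withDensityᵥ_eq_withDensity_pos_part_sub_withDensity_neg_part hw,
    VectorMeasure.integral_sub_vectorMeasure (hi _) (hi _),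
    VectorMeasure.integral_toSignedMeasure, VectorMeasure.integral_toSignedMeasure,
    integral_withDensity_eq_integral_toReal_smul₀ hw.1.aemeasurable.ennreal_ofReal (by simp),
    integral_withDensity_eq_integral_toReal_smul₀ hneg (by simp),
    ← integral_sub]
  · refine integral_congr_ae (Filter.Eventually.of_forall fun x => ?_)
    simp only [ENNReal.toReal_ofReal', smul_eq_mul]
    rcases le_total 0 (w x) with h0 | h0
    · rw [max_eq_left h0, max_eq_right (by simpa using h0)]
      ring
    · rw [max_eq_right h0, max_eq_left (by simpa using h0)]
      ring
  · refine (hp _ hw.pos_part).congr (Filter.Eventually.of_forall fun x => ?_)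
    simp [ENNReal.toReal_ofReal', mul_comm]
  · refine (hp _ hw.neg_part).congr (Filter.Eventually.of_forall fun x => ?_)
    simp [ENNReal.toReal_ofReal', mul_comm]

namespace WeightedGraph

variable {V E : Type*} [Fintype V] [Fintype E] (G : WeightedGraph V E)

/-! ### The topology of a metric graph -/

@[simp] theorem edgePt_zero (e : E) : G.edgePt e 0 = .vertex (G.src e) := by simp [edgePt]

@[simp] theorem edgePt_len (e : E) : G.edgePt e (G.len e) = .vertex (G.tgt e) := by
  simp [edgePt, G.len_pos e]

theorem edgePt_of_mem {e : E} {t : ℝ} (ht : t ∈ Ioo 0 (G.len e)) :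
    G.edgePt e t = .interior e t ht.1 ht.2 := by
  simp [edgePt, ht.1, ht.2]

theorem edgePt_clamp (e : E) (t : ℝ) : G.edgePt e (max 0 (min t (G.len e))) = G.edgePt e t := by
  have hL := G.len_pos e
  rcases le_or_gt t 0 with h | h
  · rw [min_eq_left (h.trans hL.le), max_eq_left h]
    simp [edgePt, h.not_gt]
  · rcases lt_or_ge t (G.len e) with h' | h'
    · rw [min_eq_left h'.le, max_eq_right h.le]
    · rw [min_eq_right h', max_eq_right hL.le]
      simp [edgePt, h, h'.not_gt, hL]

theorem continuous_of_edges {X : Type*} [TopologicalSpace X] {f : G.Point → X}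
    (h : ∀ e, Continuous (f ∘ G.edgePt e)) : Continuous f :=
  continuous_iSup_dom.2 fun e => continuous_coinduced_dom.2 (h e)

/-- A formula on the closed segment is enough, because the parametrization factors through the
clamping of ℝ to [0, len e]. -/
theorem continuous_of_eqOn {f : G.Point → ℝ}
    (h : ∀ e, ∃ F : ℝ → ℝ, Continuous F ∧ ∀ t ∈ Icc 0 (G.len e), f (G.edgePt e t) = F t) :
    Continuous f := by
  refine G.continuous_of_edges fun e => ?_
  obtain ⟨F, hF, hfF⟩ := h e
  have : f ∘ G.edgePt e = fun t => F (max 0 (min t (G.len e))) := by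
    ext t
    rw [Function.comp_apply, ← edgePt_clamp, hfF]
    exact ⟨le_max_left _ _, max_le (G.len_pos e).le (min_le_right _ _)⟩
  rw [this]
  fun_prop

instance : CompactSpace G.Point := by
  -- The vertices are listed separately so that the graph without edges is covered.
  have h : (univ : Set G.Point) =
      range Point.vertex ∪ ⋃ e, G.edgePt e '' Icc 0 (G.len e) := by
    symm
    rw [eq_univ_iff_forall]
    rintro (v | ⟨e, t, h₀, h₁⟩)
    · exact Or.inl ⟨v, rfl⟩
    · exact Or.inr (mem_iUnion.2 ⟨e, t, ⟨h₀.le, h₁.le⟩, G.edgePt_of_mem ⟨h₀, h₁⟩⟩)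
  refine ⟨?_⟩
  rw [h]
  exact (finite_range _).isCompact.union
    (isCompact_iUnion fun e => isCompact_Icc.image (G.continuous_edgePt e))

variable {G}

theorem exists_bound {h : G.Point → ℝ} (hc : Continuous h) : ∃ C, ∀ x, |h x| ≤ C := by
  obtain ⟨C, hC⟩ := isCompact_univ.exists_bound_of_continuousOn hc.continuousOn
  exact ⟨C, fun x => hC x trivial⟩

theorem integrable_of_continuous {h : G.Point → ℝ} (hc : Continuous h) (μ : Measure G.Point)
    [IsFiniteMeasure μ] : Integrable h μ := by
  obtain ⟨C, hC⟩ := exists_bound hc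
  exact Integrable.of_bound hc.measurable.aestronglyMeasurable C (Filter.Eventually.of_forall hC)

/-! ### The Laplacian in terms of expansions along the edges -/

variable (G)

/-- The contribution of an edge to `-Δ f`, for a function with the given expansion. -/
def edgeMeasure (e : E) (w : ℝ → ℝ) (b : ℝ) (k : ℝ →₀ ℝ) : SignedMeasure G.Point :=
  ((volume.restrict (Ioo 0 (G.len e))).withDensityᵥ w).map (G.edgePt e)
    + b • G.pointMass (.vertex (G.src e))
    - (b + (∫ t in (0 : ℝ)..G.len e, w t) + k.sum fun _ m => m) • G.pointMass (.vertex (G.tgt e))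
    + k.sum fun p m => m • G.pointMass (G.edgePt e p)

theorem integral_pointMass {h : G.Point → ℝ} (hc : Continuous h) (p : G.Point) :
    ∫ᵛ x, h x ∂<•G.pointMass p = h p := by
  rw [pointMass, VectorMeasure.integral_toSignedMeasure,
    integral_dirac' _ _ hc.measurable.stronglyMeasurable]

theorem integral_edgeMeasure {h : G.Point → ℝ} (hc : Continuous h) (e : E) {w : ℝ → ℝ}
    (hw : Integrable w) (b : ℝ) (k : ℝ →₀ ℝ) :
    ∫ᵛ x, h x ∂<•G.edgeMeasure e w b k = edgePairing (G.len e) w b k (h ∘ G.edgePt e) := by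
  have hi : ∀ s : SignedMeasure G.Point, Integrable h s.variation := fun s =>
    integrable_of_continuous hc _
  obtain ⟨C, hC⟩ := exists_bound hc
  have hcm : Measurable (h ∘ G.edgePt e) := (hc.comp (G.continuous_edgePt e)).measurable
  have hsum : ∫ᵛ x, h x ∂<•(k.sum fun p m => m • G.pointMass (G.edgePt e p)) =
      k.sum fun p m => m * h (G.edgePt e p) := by
    rw [Finsupp.sum, VectorMeasure.integral_finsetSum_vectorMeasure (fun _ _ => hi _)]
    simp only [VectorMeasure.integral_smul_vectorMeasure, integral_pointMass _ hc, smul_eq_mul,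
      Finsupp.sum]
  have hwd := integral_withDensityᵥ (hw.restrict (s := Ioo 0 (G.len e))) hcm (fun x => hC _)
  simp only [Function.comp_apply] at hwd
  rw [edgeMeasure, VectorMeasure.integral_add_vectorMeasure (hi _) (hi _),
    VectorMeasure.integral_sub_vectorMeasure (hi _) (hi _),
    VectorMeasure.integral_add_vectorMeasure (hi _) (hi _),
    VectorMeasure.integral_smul_vectorMeasure, VectorMeasure.integral_smul_vectorMeasure,
    integral_pointMass _ hc, integral_pointMass _ hc, hsum,
    VectorMeasure.integral_map (G.continuous_edgePt e).measurable
      hc.measurable.aestronglyMeasurable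
      (Integrable.of_bound hcm.aestronglyMeasurable C (Filter.Eventually.of_forall fun x => hC _)),
    hwd, edgePairing,
    intervalIntegral.integral_of_le (G.len_pos e).le, integral_Ioc_eq_integral_Ioo,
    intervalIntegral.integral_of_le (G.len_pos e).le, integral_Ioc_eq_integral_Ioo]
  simp only [Function.comp_apply, edgePt_zero, edgePt_len, smul_eq_mul]

theorem finsum_point {M : Type*} [AddCommMonoid M] (F : G.Point → M) (k : E → ℝ →₀ ℝ)
    (hk : ∀ e p, k e p ≠ 0 → p ∈ Ioo 0 (G.len e))
    (h : ∀ e t h₀ h₁, k e t = 0 → F (.interior e t h₀ h₁) = 0) :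
    ∑ᶠ p, F p = ∑ v, F (.vertex v) + ∑ e, ∑ t ∈ (k e).support, F (G.edgePt e t) := by
  have hk' : ∀ e (p : (k e).support), p.1 ∈ Ioo 0 (G.len e) := fun e p =>
    hk e p (Finsupp.mem_support_iff.1 p.2)
  let i : (V ⊕ Σ e, (k e).support) → G.Point := fun z => match z with
    | .inl v => .vertex v
    | .inr ⟨e, p⟩ => .interior e p.1 (hk' e p).1 (hk' e p).2
  have hi : Function.Injective i := by
    rintro (v | ⟨e, p⟩) (v' | ⟨e', p'⟩) hz
    · simpa [i] using hz
    · simp [i] at hz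
    · simp [i] at hz
    · simp only [i, Point.interior.injEq] at hz
      obtain ⟨rfl, hz⟩ := hz
      rw [Subtype.ext hz]
  rw [finsum_eq_sum_of_support_subset (s := Finset.univ.map ⟨i, hi⟩), Finset.sum_map,
    Fintype.sum_sum_type, Fintype.sum_sigma]
  · congr 1
    refine Finset.sum_congr rfl fun e _ => ?_
    rw [← Finset.sum_coe_sort (k e).support fun t => F (G.edgePt e t)]
    refine Finset.sum_congr rfl fun p _ => ?_
    rw [G.edgePt_of_mem (hk' e p)]
    rfl
  · rintro (v | ⟨e, t, h₀, h₁⟩) hp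
    · exact Finset.mem_coe.2 (Finset.mem_map.2 ⟨Sum.inl v, Finset.mem_univ _, rfl⟩)
    · have ht : k e t ≠ 0 := fun h0 => hp (h e t h₀ h₁ h0)
      exact Finset.mem_coe.2 (Finset.mem_map.2
        ⟨Sum.inr ⟨e, t, Finsupp.mem_support_iff.2 ht⟩, Finset.mem_univ _, rfl⟩)

theorem sum_sub_smul {ι X : Type*} [MeasurableSpace X] (s : Finset ι) (a b : ι → ℝ)
    (ν : ι → SignedMeasure X) :
    ∑ i ∈ s, (a i - b i) • ν i = ∑ i ∈ s, a i • ν i - ∑ i ∈ s, b i • ν i := by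
  rw [← Finset.sum_sub_distrib]
  exact Finset.sum_congr rfl fun i _ => sub_smul (a i) (b i) (ν i)

theorem sum_fiber_smul {X : Type*} [MeasurableSpace X] (s : E → V) (b : E → ℝ)
    (ν : V → SignedMeasure X) [DecidableEq V] :
    ∑ v, (∑ e with s e = v, b e) • ν v = ∑ e, b e • ν (s e) := by
  ext A -
  simp only [_root_.sum_apply, _root_.smul_apply, smul_eq_mul, Finset.sum_mul, Finset.sum_filter]
  rw [Finset.sum_comm]
  simp

variable {G}

/-- Expansions along all the edges of a function on `Γ`. -/
structure HasExpansion (f : G.Point → ℝ) (w : E → ℝ → ℝ) (b : E → ℝ) (k : E → ℝ →₀ ℝ) : Prop where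
  expansion : ∀ e, KinkExpansion (f ∘ G.edgePt e) (G.len e) (w e) (b e) (k e)
  secondDeriv : ∀ e, G.secondDeriv f e =ᵐ[volume.restrict (Ioo 0 (G.len e))] w e

/-- The outward slopes at the vertices are regrouped by edges, each edge contributing its two end
slopes, its density and its interior jumps. Integrals against the Laplacian can then be computed one
edge at a time. -/
theorem HasExpansion.laplacian_eq {f : G.Point → ℝ} {w : E → ℝ → ℝ} {b : E → ℝ} {k : E → ℝ →₀ ℝ}
    (h : HasExpansion f w b k) :
    G.laplacian f = -∑ e, G.edgeMeasure e (w e) (b e) (k e) := by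
  classical
  have hint : ∀ e t (h₀ : 0 < t) (h₁ : t < G.len e),
      G.outwardDeriv f (.interior e t h₀ h₁) = k e t := fun e t h₀ h₁ =>
    (h.expansion e).derivWithin_sub ⟨h₀, h₁⟩
  have hver : ∀ v, G.outwardDeriv f (.vertex v) = (∑ e with G.src e = v, b e)
      - ∑ e with G.tgt e = v, (b e + (∫ y in (0 : ℝ)..G.len e, w e y) + (k e).sum fun _ m => m) := by
    intro v
    simp only [outwardDeriv]
    congr 1
    · refine Finset.sum_congr (by ext; simp) fun e _ => ?_
      exact (h.expansion e).derivWithin_zero (G.len_pos e)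
    · refine Finset.sum_congr (by ext; simp) fun e _ => ?_
      exact (h.expansion e).derivWithin_length (G.len_pos e)
  rw [laplacian, G.finsum_point _ k (fun e => (h.expansion e).mem_Ioo)
    (fun e t h₀ h₁ h0 => by rw [hint, h0, zero_smul])]
  simp only [hver]
  rw [sum_sub_smul]
  have hs := fun s b => sum_fiber_smul (E := E) s b fun v => G.pointMass (.vertex v)
  rw [hs, hs]
  simp only [edgeMeasure, Finset.sum_add_distrib, Finset.sum_sub_distrib]
  have h1 : ∀ e, (volume.restrict (Ioo 0 (G.len e))).withDensityᵥ (G.secondDeriv f e) =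
      (volume.restrict (Ioo 0 (G.len e))).withDensityᵥ (w e) := fun e =>
    WithDensityᵥEq.congr_ae (h.secondDeriv e)
  have h2 : ∀ e, ∑ t ∈ (k e).support, G.outwardDeriv f (G.edgePt e t) • G.pointMass (G.edgePt e t) =
      (k e).sum fun p m => m • G.pointMass (G.edgePt e p) := fun e =>
    Finset.sum_congr rfl fun t ht => by
      beta_reduce
      rw [G.edgePt_of_mem ((h.expansion e).mem_Ioo t (Finsupp.mem_support_iff.1 ht)), hint]
  simp only [h1, h2]
  abel

theorem HasExpansion.integral_laplacian {f : G.Point → ℝ} {w : E → ℝ → ℝ} {b : E → ℝ}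
    {k : E → ℝ →₀ ℝ} (hf : HasExpansion f w b k) {h : G.Point → ℝ} (hc : Continuous h) :
    ∫ᵛ x, h x ∂<•G.laplacian f =
      -∑ e, edgePairing (G.len e) (w e) (b e) (k e) (h ∘ G.edgePt e) := by
  rw [hf.laplacian_eq, VectorMeasure.integral_neg_vectorMeasure,
    VectorMeasure.integral_finsetSum_vectorMeasure (fun _ _ => integrable_of_continuous hc _)]
  simp only [G.integral_edgeMeasure hc _ (hf.expansion _).integrable]

theorem InDomain.exists_hasExpansion {f : G.Point → ℝ} (hf : G.InDomain f) :
    ∃ w b k, HasExpansion f w b k := by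
  obtain ⟨S, hS, hC⟩ := hf.contDiffOn
  have key : ∀ e, ∃ b k, KinkExpansion (f ∘ G.edgePt e) (G.len e)
      ((Ioo 0 (G.len e)).indicator (G.secondDeriv f e)) b k := by
    intro e
    -- The parametrization is injective on the open edge, so the finite exceptional set pulls back
    -- to a finite set.
    have hfin : {t | t ∈ Ioo 0 (G.len e) ∧ G.edgePt e t ∈ S}.Finite := by
      refine Finite.of_finite_image (f := G.edgePt e) (hS.subset ?_) ?_
      · rintro _ ⟨t, ht, rfl⟩
        exact ht.2
      · intro t ht s hs hts
        rw [G.edgePt_of_mem ht.1, G.edgePt_of_mem hs.1] at hts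
        simpa using hts
    refine exists_kinkExpansion (G.len_pos e) (hf.continuous.comp (G.continuous_edgePt e))
      hfin.toFinset ((hC e).mono ?_) ?_
    · rintro t ⟨h1, h2⟩
      refine ⟨h1, fun h3 => h2 ?_⟩
      simpa using ⟨h1, h3⟩
    -- Square integrable implies integrable, the edge having finite length.
    · exact (hf.memLp e).integrable (by norm_num)
  choose b k h using key
  refine ⟨_, b, k, h, fun e => ?_⟩
  filter_upwards [ae_restrict_mem measurableSet_Ioo] with t ht
  rw [indicator_of_mem ht]

end WeightedGraph
namespace WeightedGraph

variable {V E : Type*} [Fintype V] [Fintype E] (G : WeightedGraph V E)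

/-! ### Piecewise quadratic functions -/

/-- The Lebesgue measure on an edge. -/
def edgeLebesgue (e : E) : Measure G.Point := (volume.restrict (Ioo 0 (G.len e))).map (G.edgePt e)

instance (e : E) : IsFiniteMeasure (G.edgeLebesgue e) := by
  unfold edgeLebesgue
  infer_instance

/-- The function `f` is given by a quadratic polynomial on each edge, up to finitely many changes
of slope. -/
structure IsPiecewiseQuadratic (f : G.Point → ℝ) (b c : E → ℝ) (k : E → ℝ →₀ ℝ) : Prop where
  mem_Ioo : ∀ e p, k e p ≠ 0 → p ∈ Ioo 0 (G.len e)
  eq : ∀ e, ∀ t ∈ Icc 0 (G.len e), f (G.edgePt e t) =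
    f (.vertex (G.src e)) + b e * t + c e * t ^ 2 / 2 + kinkSum (k e) t

/-- The negative of the Laplacian of a piecewise quadratic function, on an edge. -/
def quadraticMeasure (e : E) (b c : ℝ) (k : ℝ →₀ ℝ) : SignedMeasure G.Point :=
  c • (G.edgeLebesgue e).toSignedMeasure + b • G.pointMass (.vertex (G.src e))
    - (b + c * G.len e + k.sum fun _ m => m) • G.pointMass (.vertex (G.tgt e))
    + k.sum fun p m => m • G.pointMass (G.edgePt e p)

/-- The function `f` is piecewise quadratic, with Laplacian `ν`. -/
def HasLaplacian (f : G.Point → ℝ) (ν : SignedMeasure G.Point) : Prop :=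
  ∃ b c k, G.IsPiecewiseQuadratic f b c k ∧ ν = -∑ e, G.quadraticMeasure e (b e) (c e) (k e)

variable {G}

theorem quadraticMeasure_add (e : E) (b c b' c' : ℝ) (k k' : ℝ →₀ ℝ) :
    G.quadraticMeasure e (b + b') (c + c') (k + k') =
      G.quadraticMeasure e b c k + G.quadraticMeasure e b' c' k' := by
  unfold quadraticMeasure
  rw [Finsupp.sum_add_index' (fun _ => rfl) (fun _ _ _ => rfl),
    Finsupp.sum_add_index' (fun _ => by simp) (fun _ _ _ => by module)]
  module

theorem quadraticMeasure_smul (e : E) (r b c : ℝ) (k : ℝ →₀ ℝ) :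
    G.quadraticMeasure e (r * b) (r * c) (r • k) = r • G.quadraticMeasure e b c k := by
  unfold quadraticMeasure
  rw [Finsupp.sum_smul_index' (fun _ => rfl), Finsupp.sum_smul_index' (fun _ => by simp)]
  have h1 : (k.sum fun _ m => r • m) = r * k.sum fun _ m => m := by
    rw [Finsupp.mul_sum]
    rfl
  have h2 : (k.sum fun p m => (r • m) • G.pointMass (G.edgePt e p)) =
      r • k.sum fun p m => m • G.pointMass (G.edgePt e p) := by
    rw [Finsupp.smul_sum]
    exact Finset.sum_congr rfl fun p _ => by module
  rw [h1, h2]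
  module

namespace HasLaplacian

variable {f f' : G.Point → ℝ} {ν ν' : SignedMeasure G.Point}

protected theorem add (h : G.HasLaplacian f ν) (h' : G.HasLaplacian f' ν') :
    G.HasLaplacian (fun x => f x + f' x) (ν + ν') := by
  obtain ⟨b, c, k, hf, rfl⟩ := h
  obtain ⟨b', c', k', hf', rfl⟩ := h'
  refine ⟨fun e => b e + b' e, fun e => c e + c' e, fun e => k e + k' e, ⟨fun e p hp => ?_,
    fun e t ht => ?_⟩, ?_⟩
  · by_cases h0 : k e p = 0
    · refine hf'.mem_Ioo e p fun h1 => hp ?_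
      rw [Finsupp.add_apply, h0, h1, add_zero]
    · exact hf.mem_Ioo e p h0
  · rw [hf.eq e t ht, hf'.eq e t ht, kinkSum_add]
    ring
  · simp only [quadraticMeasure_add, Finset.sum_add_distrib]
    abel

protected theorem smul (h : G.HasLaplacian f ν) (r : ℝ) :
    G.HasLaplacian (fun x => r * f x) (r • ν) := by
  obtain ⟨b, c, k, hf, rfl⟩ := h
  refine ⟨fun e => r * b e, fun e => r * c e, fun e => r • k e, ⟨fun e p hp => ?_,
    fun e t ht => ?_⟩, ?_⟩
  · refine hf.mem_Ioo e p fun h1 => hp ?_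
    rw [Finsupp.smul_apply, h1, smul_zero]
  · rw [hf.eq e t ht, kinkSum_smul]
    ring
  · simp only [quadraticMeasure_smul, ← Finset.smul_sum, smul_neg]

theorem const (a : ℝ) : G.HasLaplacian (fun _ => a) 0 := by
  refine ⟨0, 0, 0, ⟨by simp, by simp⟩, ?_⟩
  simp [quadraticMeasure]

protected theorem sub (h : G.HasLaplacian f ν) (h' : G.HasLaplacian f' ν') :
    G.HasLaplacian (fun x => f x - f' x) (ν - ν') := by
  convert h.add (h'.smul (-1)) using 1
  · ext x
    ring
  · module

protected theorem sum {ι : Type*} (s : Finset ι) {f : ι → G.Point → ℝ}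
    {ν : ι → SignedMeasure G.Point} (h : ∀ i ∈ s, G.HasLaplacian (f i) (ν i)) :
    G.HasLaplacian (fun x => ∑ i ∈ s, f i x) (∑ i ∈ s, ν i) := by
  classical
  induction s using Finset.induction_on with
  | empty => simpa using const 0
  | insert i s hi ih =>
    simp only [Finset.sum_insert hi]
    exact (h i (Finset.mem_insert_self i s)).add
      (ih fun j hj => h j (Finset.mem_insert_of_mem hj))

end HasLaplacian

/-! ### Regularity and Laplacians of piecewise quadratic functions -/

theorem continuous_kinkSum (k : ℝ →₀ ℝ) : Continuous (kinkSum k) := by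
  unfold kinkSum Finsupp.sum
  fun_prop

theorem kinkSum_eventuallyEq {k : ℝ →₀ ℝ} {t : ℝ} (ht : k t = 0) :
    ∃ A B : ℝ, kinkSum k =ᶠ[nhds t] fun s => A + B * s := by
  refine ⟨∑ p ∈ k.support, if p < t then -(k p * p) else 0,
    ∑ p ∈ k.support, if p < t then k p else 0, ?_⟩
  have h : ∀ p ∈ k.support, ∀ᶠ s in nhds t, k p * max (s - p) 0 =
      (if p < t then -(k p * p) else 0) + (if p < t then k p else 0) * s := by
    intro p hp
    rcases lt_trichotomy p t with h | h | h
    · filter_upwards [Ioi_mem_nhds h] with s hs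
      rw [if_pos h, if_pos h, max_eq_left (by linarith [mem_Ioi.1 hs])]
      ring
    · rw [h] at hp
      exact absurd ht (Finsupp.mem_support_iff.1 hp)
    · filter_upwards [Iio_mem_nhds h] with s hs
      rw [if_neg h.not_gt, if_neg h.not_gt, max_eq_right (by linarith [mem_Iio.1 hs])]
      ring
  filter_upwards [(Filter.eventually_all_finset _).2 h] with s hs
  rw [Finset.sum_mul, ← Finset.sum_add_distrib]
  exact Finset.sum_congr rfl hs

namespace IsPiecewiseQuadratic

variable {f : G.Point → ℝ} {b c : E → ℝ} {k : E → ℝ →₀ ℝ}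

theorem continuous (h : G.IsPiecewiseQuadratic f b c k) : Continuous f :=
  G.continuous_of_eqOn fun e =>
    ⟨_, Continuous.add (by fun_prop) (continuous_kinkSum (k e)), h.eq e⟩

theorem eventuallyEq (h : G.IsPiecewiseQuadratic f b c k) {e : E} {t : ℝ}
    (ht : t ∈ Ioo 0 (G.len e)) (hk : k e t = 0) :
    ∃ A B : ℝ, f ∘ G.edgePt e =ᶠ[nhds t] fun s => A + B * s + c e * s ^ 2 / 2 := by
  obtain ⟨A, B, hAB⟩ := kinkSum_eventuallyEq hk
  refine ⟨f (.vertex (G.src e)) + A, b e + B, ?_⟩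
  filter_upwards [hAB, Ioo_mem_nhds ht.1 ht.2] with s hs hs'
  rw [Function.comp_apply, h.eq e s (Ioo_subset_Icc_self hs'), hs]
  ring

theorem secondDeriv_eq (h : G.IsPiecewiseQuadratic f b c k) {e : E} {t : ℝ}
    (ht : t ∈ Ioo 0 (G.len e)) (hk : k e t = 0) : G.secondDeriv f e t = c e := by
  obtain ⟨A, B, hAB⟩ := h.eventuallyEq ht hk
  have h1 : deriv (fun s => A + B * s + c e * s ^ 2 / 2) = fun s => B + c e * s := by
    ext s
    have : HasDerivAt (fun s => A + B * s + c e * s ^ 2 / 2) (B * 1 + c e * (2 * s) / 2) s :=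
      (((hasDerivAt_id s).const_mul B).const_add A).add
        ((((by simpa using hasDerivAt_pow 2 s) : HasDerivAt (fun s : ℝ => s ^ 2) (2 * s) s).const_mul
          (c e)).div_const 2)
    rw [this.deriv]
    ring
  have h2 : deriv (fun s => B + c e * s) t = c e := by
    have : HasDerivAt (fun s => B + c e * s) (c e * 1) t :=
      ((hasDerivAt_id t).const_mul (c e)).const_add B
    rw [this.deriv, mul_one]
  rw [secondDeriv, hAB.deriv.deriv_eq, h1, h2]

theorem secondDeriv_ae_eq (h : G.IsPiecewiseQuadratic f b c k) (e : E) :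
    G.secondDeriv f e =ᵐ[volume.restrict (Ioo 0 (G.len e))]
      (Ioo 0 (G.len e)).indicator fun _ => c e := by
  have hfin : ∀ᵐ t ∂volume.restrict (Ioo 0 (G.len e)), t ∉ ((k e).support : Set ℝ) :=
    ae_restrict_of_ae ((k e).support.finite_toSet.countable.ae_notMem _)
  filter_upwards [hfin, ae_restrict_mem measurableSet_Ioo] with t h1 h2
  rw [indicator_of_mem h2, h.secondDeriv_eq h2 (by simpa using h1)]

theorem inDomain (h : G.IsPiecewiseQuadratic f b c k) : G.InDomain f := by
  refine ⟨h.continuous, ⟨⋃ e, G.edgePt e '' (k e).support,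
    finite_iUnion fun e => (k e).support.finite_toSet.image _, fun e t ht => ?_⟩, fun e => ?_⟩
  · have hk : k e t = 0 := by
      by_contra h0
      exact ht.2 (mem_iUnion.2 ⟨e, t, Finsupp.mem_support_iff.2 h0, rfl⟩)
    obtain ⟨A, B, hAB⟩ := h.eventuallyEq ht.1 hk
    exact (ContDiffAt.congr_of_eventuallyEq (by fun_prop) hAB).contDiffWithinAt
  · refine (memLp_congr_ae (h.secondDeriv_ae_eq e)).2 ?_
    exact (memLp_const (c e)).indicator measurableSet_Ioo

theorem integral_indicator_const {L t c : ℝ} (ht : t ∈ Icc 0 L) :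
    ∫ x in (0 : ℝ)..t, (Ioo 0 L).indicator (fun _ => c) x = c * t := by
  rw [intervalIntegral.integral_of_le ht.1, integral_Ioc_eq_integral_Ioo,
    setIntegral_congr_fun (g := fun _ => c) measurableSet_Ioo fun x hx =>
      indicator_of_mem (show x ∈ Ioo 0 L from ⟨hx.1, hx.2.trans_le ht.2⟩) _]
  simp [ht.1, mul_comm]

theorem hasExpansion (h : G.IsPiecewiseQuadratic f b c k) :
    HasExpansion f (fun e => (Ioo 0 (G.len e)).indicator fun _ => c e) b k := by
  refine ⟨fun e => ⟨h.mem_Ioo e, ?_, fun t ht => ?_⟩, h.secondDeriv_ae_eq⟩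
  · exact (integrableOn_const (by simp)).integrable_indicator measurableSet_Ioo
  · rw [Function.comp_apply, h.eq e t ht, Function.comp_apply, edgePt_zero]
    have : ∫ x in (0 : ℝ)..t, ∫ y in (0 : ℝ)..x, (Ioo 0 (G.len e)).indicator (fun _ => c e) y =
        ∫ x in (0 : ℝ)..t, c e * x := by
      refine intervalIntegral.integral_congr fun x hx => ?_
      rw [uIcc_of_le ht.1] at hx
      exact integral_indicator_const ⟨hx.1, hx.2.trans ht.2⟩
    rw [this, intervalIntegral.integral_const_mul, integral_id]
    ring

/-- Ties the bookkeeping by coefficients to the analytic Laplacian. Laplacians of explicit functions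
can afterwards be found by linear algebra with `HasLaplacian`, without differentiating. -/
theorem laplacian_eq (h : G.IsPiecewiseQuadratic f b c k) :
    G.laplacian f = -∑ e, G.quadraticMeasure e (b e) (c e) (k e) := by
  rw [h.hasExpansion.laplacian_eq]
  congr 1
  refine Finset.sum_congr rfl fun e _ => ?_
  rw [edgeMeasure, quadraticMeasure,
    integral_indicator_const (right_mem_Icc.2 (G.len_pos e).le)]
  congr 3
  rw [WithDensityᵥEq.congr_ae (g := fun _ => c e) (by
    filter_upwards [ae_restrict_mem measurableSet_Ioo] with t ht
    rw [indicator_of_mem ht])]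
  ext A hA
  have hA' := (G.continuous_edgePt e).measurable hA
  rw [VectorMeasure.map_apply _ (G.continuous_edgePt e).measurable hA,
    withDensityᵥ_apply (integrable_const _) hA', setIntegral_const, _root_.smul_apply,
    Measure.toSignedMeasure_apply_measurable hA, edgeLebesgue, measureReal_def, measureReal_def,
    Measure.map_apply (G.continuous_edgePt e).measurable hA]
  simp [mul_comm]

end IsPiecewiseQuadratic

namespace HasLaplacian

variable {f : G.Point → ℝ} {ν : SignedMeasure G.Point}

theorem inDomain (h : G.HasLaplacian f ν) : G.InDomain f := by
  obtain ⟨b, c, k, hf, -⟩ := h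
  exact hf.inDomain

theorem laplacian_eq (h : G.HasLaplacian f ν) : G.laplacian f = ν := by
  obtain ⟨b, c, k, hf, rfl⟩ := h
  exact hf.laplacian_eq

end HasLaplacian

end WeightedGraph

theorem edgePairing_congr {L : ℝ} {w : ℝ → ℝ} {b : ℝ} {k : ℝ →₀ ℝ} {H H' : ℝ → ℝ} (hL : 0 ≤ L)
    (hk : ∀ p, k p ≠ 0 → p ∈ Ioo 0 L) (h : ∀ t ∈ Icc 0 L, H t = H' t) :
    edgePairing L w b k H = edgePairing L w b k H' := by
  unfold edgePairing
  rw [h 0 ⟨le_rfl, hL⟩, h L ⟨hL, le_rfl⟩,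
    intervalIntegral.integral_congr (g := fun t => H' t * w t) fun t ht => by
      rw [uIcc_of_le hL] at ht
      simp only [h t ht]]
  congr 1
  exact Finset.sum_congr rfl fun p hp => by
    beta_reduce
    rw [h p (Ioo_subset_Icc_self (hk p (Finsupp.mem_support_iff.1 hp)))]

namespace WeightedGraph

variable {V E : Type*} [Fintype V] [Fintype E] (G : WeightedGraph V E)

/-! ### Potential theory on the vertices -/

/-- The Dirichlet form of the weighted graph. -/
def energy (f h : V → ℝ) : ℝ :=
  ∑ e, (f (G.tgt e) - f (G.src e)) * (h (G.tgt e) - h (G.src e)) / G.len e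

theorem energy_comm (f h : V → ℝ) : G.energy f h = G.energy h f :=
  Finset.sum_congr rfl fun e _ => by rw [mul_comm (f _ - _)]

theorem energy_self_term_nonneg (f : V → ℝ) (e : E) :
    0 ≤ (f (G.tgt e) - f (G.src e)) * (f (G.tgt e) - f (G.src e)) / G.len e :=
  div_nonneg (mul_self_nonneg _) (G.len_pos e).le

theorem eq_of_forall_edge {f : V → ℝ} (h : ∀ e, f (G.tgt e) = f (G.src e)) (v w : V) :
    f v = f w := by
  have := G.connected v w
  induction this with
  | rel a b h' =>
    obtain ⟨e, rfl, rfl⟩ := h'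
    exact (h e).symm
  | refl a => rfl
  | symm a b _ ih => exact ih.symm
  | trans a b c _ _ ih₁ ih₂ => exact ih₁.trans ih₂

theorem eq_of_energy_self_eq_zero {f : V → ℝ} (h : G.energy f f = 0) (v w : V) : f v = f w := by
  refine G.eq_of_forall_edge (fun e => ?_) v w
  have h0 := (Finset.sum_eq_zero_iff_of_nonneg fun e _ => G.energy_self_term_nonneg f e).1 h e
    (Finset.mem_univ e)
  have := (div_eq_zero_iff.1 h0).resolve_right (G.len_pos e).ne'
  linarith [mul_self_eq_zero.1 this]

/-- `J` is the inverse of the Laplace matrix of the weighted graph, perturbed at `z`. -/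
structure IsPotential (z : V) (J : V → V → ℝ) : Prop where
  symm : ∀ v w, J v w = J w v
  base : ∀ w, J z w = 1
  energy_eq : ∀ f w, G.energy f (J w) = f w - f z

/-- The form whose inverse is the potential. -/
def groundedForm (z : V) : (V → ℝ) →ₗ[ℝ] (V → ℝ) →ₗ[ℝ] ℝ :=
  LinearMap.mk₂ ℝ (fun h f => G.energy f h + f z * h z)
    (fun a b c => by
      simp only [energy, Pi.add_apply, mul_add (c z)]
      rw [add_add_add_comm, ← Finset.sum_add_distrib]
      congr 1
      exact Finset.sum_congr rfl fun e _ => by ring)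
    (fun r b c => by
      simp only [energy, Pi.smul_apply, smul_eq_mul, mul_add, Finset.mul_sum]
      congr 1
      · exact Finset.sum_congr rfl fun e _ => by ring
      · ring)
    (fun a b c => by
      simp only [energy, Pi.add_apply, add_mul]
      rw [add_add_add_comm, ← Finset.sum_add_distrib]
      congr 1
      exact Finset.sum_congr rfl fun e _ => by ring)
    (fun r b c => by
      simp only [energy, Pi.smul_apply, smul_eq_mul, mul_add, Finset.mul_sum]
      congr 1
      · exact Finset.sum_congr rfl fun e _ => by ring
      · ring)

/-- The form energy(f, h) + f(z) h(z) is positive definite: zero energy forces a constant by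
connectedness, and the term at z excludes nonzero constants. It is therefore invertible, and J w is
the vector representing evaluation at w; testing it against the constant 1 gives J w z = 1. -/
theorem exists_isPotential (z : V) : ∃ J, G.IsPotential z J := by
  have hinj : Function.Injective (G.groundedForm z) := by
    rw [injective_iff_map_eq_zero]
    intro h hh
    have h0 : G.energy h h + h z * h z = 0 := by
      have := LinearMap.congr_fun hh h
      simpa [groundedForm] using this
    have h1 : 0 ≤ G.energy h h := Finset.sum_nonneg fun e _ => G.energy_self_term_nonneg h e
    have h2 : G.energy h h = 0 := by nlinarith [mul_self_nonneg (h z)]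
    have h3 : h z = 0 := mul_self_eq_zero.1 (by linarith)
    ext v
    rw [G.eq_of_energy_self_eq_zero h2 v z, h3, Pi.zero_apply]
  have hsurj : Function.Surjective (G.groundedForm z) :=
    (LinearMap.injective_iff_surjective_of_finrank_eq_finrank
      (Subspace.dual_finrank_eq (K := ℝ) (V := V → ℝ)).symm).1 hinj
  choose J hJ using fun w => hsurj (LinearMap.proj w)
  have key : ∀ f w, G.energy f (J w) + f z * J w z = f w := fun f w => by
    simpa [groundedForm] using LinearMap.congr_fun (hJ w) f
  have hsymm : ∀ v w, J v w = J w v := fun v w => by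
    rw [← key (J v) w, ← key (J w) v, energy_comm, mul_comm]
  have hone : ∀ w, J w z = 1 := fun w => by
    simpa [energy] using key (fun _ => 1) w
  refine ⟨J, hsymm, fun w => by rw [hsymm, hone], fun f w => ?_⟩
  have := key f w
  rw [hone] at this
  linarith

variable {G} in
-- The left side R is the effective resistance between the ends of e. The potential h = J t - J s
-- has energy R and changes by R across e, so the energy of that single edge gives R²/ℓ(e) ≤ R. This
-- is what makes the density of the admissible measure nonnegative.
theorem IsPotential.resistance_le {z : V} {J : V → V → ℝ} (hJ : G.IsPotential z J) (e : E) :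
    J (G.src e) (G.src e) + J (G.tgt e) (G.tgt e) - 2 * J (G.src e) (G.tgt e) ≤ G.len e := by
  set s := G.src e with hs
  set t := G.tgt e with ht
  set R := J s s + J t t - 2 * J s t with hR
  let h : V → ℝ := fun v => J t v - J s v
  have hd : h t - h s = R := by
    simp only [h, hR, hJ.symm t s]
    ring
  have h1 : G.energy h h = R := by
    have e1 := hJ.energy_eq h t
    have e2 := hJ.energy_eq h s
    have : G.energy h h = G.energy h (J t) - G.energy h (J s) := by
      unfold energy
      rw [← Finset.sum_sub_distrib]
      exact Finset.sum_congr rfl fun e _ => by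
        simp only [h]
        ring
    rw [this, e1, e2, ← hd]
    ring
  have h2 : R * R / G.len e ≤ R := by
    have := Finset.single_le_sum (fun e _ => G.energy_self_term_nonneg h e) (Finset.mem_univ e)
    rw [← ht, ← hs, hd] at this
    exact this.trans_eq h1
  have hL := G.len_pos e
  rw [div_le_iff₀ hL] at h2
  by_contra hlt
  nlinarith [not_le.1 hlt]

/-! ### Interpolation and bubbles -/

variable {G}

/-- The function on `Γ` that is affine on the edges, with given values at the vertices. -/
def interp (c : V → ℝ) : G.Point → ℝ
  | .vertex v => c v
  | .interior e t _ _ => c (G.src e) + t / G.len e * (c (G.tgt e) - c (G.src e))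

theorem interp_vertex (c : V → ℝ) (v : V) : interp c (.vertex v : G.Point) = c v := rfl

theorem interp_edgePt (c : V → ℝ) {e : E} {t : ℝ} (ht : t ∈ Icc 0 (G.len e)) :
    interp c (G.edgePt e t) = c (G.src e) + t / G.len e * (c (G.tgt e) - c (G.src e)) := by
  have hL := G.len_pos e
  rcases ht.1.eq_or_lt with rfl | h0
  · simp [interp]
  rcases ht.2.eq_or_lt with rfl | h1
  · simp [interp, hL.ne']
  rw [G.edgePt_of_mem ⟨h0, h1⟩]
  rfl

theorem interp_add (c d : V → ℝ) (x : G.Point) :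
    interp (fun v => c v + d v) x = interp c x + interp d x := by
  cases x <;> simp only [interp]
  ring

theorem interp_const_mul (r : ℝ) (c : V → ℝ) (x : G.Point) :
    interp (fun v => r * c v) x = r * interp c x := by
  cases x <;> simp only [interp]
  ring

theorem interp_const (a : ℝ) (x : G.Point) : interp (fun _ => a) x = a := by
  cases x <;> simp [interp]

open Classical in
/-- The Green's function of an edge with Dirichlet boundary conditions, extended by `0`. -/
def bubble : G.Point → G.Point → ℝ
  | .interior e t _ _, .interior e' s _ _ => if e = e' then min t s - t * s / G.len e else 0
  | .interior _ _ _ _, .vertex _ => 0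
  | .vertex _, _ => 0

@[simp] theorem bubble_vertex_left (v : V) (y : G.Point) : bubble (.vertex v) y = 0 := by
  cases y <;> rfl

@[simp] theorem bubble_vertex_right (x : G.Point) (v : V) : bubble x (.vertex v) = 0 := by
  cases x <;> rfl

theorem bubble_comm (x y : G.Point) : bubble x y = bubble y x := by
  cases x with
  | vertex v => simp
  | interior e t h₀ h₁ =>
    cases y with
    | vertex v => simp
    | interior e' s h₀ h₁ =>
      simp only [bubble]
      by_cases h : e = e'
      · subst h
        simp [min_comm, mul_comm]
      · simp [h, Ne.symm h]

theorem bubble_edgePt (e : E) {t s : ℝ} (ht : t ∈ Icc 0 (G.len e)) (hs : s ∈ Icc 0 (G.len e)) :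
    bubble (G.edgePt e t) (G.edgePt e s) = min t s - t * s / G.len e := by
  have hL := G.len_pos e
  rcases ht.1.eq_or_lt with rfl | h0
  · simp [hs.1]
  rcases ht.2.eq_or_lt with rfl | h1
  · simp [hs.2, hL.ne']
  rcases hs.1.eq_or_lt with rfl | h0'
  · simp [ht.1]
  rcases hs.2.eq_or_lt with rfl | h1'
  · simp [ht.2, hL.ne']
  rw [G.edgePt_of_mem ⟨h0, h1⟩, G.edgePt_of_mem ⟨h0', h1'⟩]
  simp [bubble]

theorem bubble_edgePt_of_ne {e e' : E} (h : e ≠ e') (t s : ℝ) :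
    bubble (G.edgePt e t) (G.edgePt e' s) = 0 := by
  unfold edgePt
  split_ifs <;> simp [bubble, h]

theorem continuous_interp (c : V → ℝ) : Continuous (interp c : G.Point → ℝ) :=
  G.continuous_of_eqOn fun e => ⟨_, by fun_prop, fun _ ht => interp_edgePt c ht⟩

theorem exists_eq_edgePt (x : G.Point) :
    (∃ v, x = .vertex v) ∨ ∃ e, ∃ t ∈ Ioo 0 (G.len e), x = G.edgePt e t := by
  rcases x with v | ⟨e, t, h₀, h₁⟩
  · exact Or.inl ⟨v, rfl⟩
  · exact Or.inr ⟨e, t, ⟨h₀, h₁⟩, (G.edgePt_of_mem ⟨h₀, h₁⟩).symm⟩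

theorem continuous_bubble_left (y : G.Point) : Continuous fun x => bubble x y := by
  rcases exists_eq_edgePt y with ⟨v, rfl⟩ | ⟨e', s, hs, rfl⟩
  · simpa using continuous_const
  refine G.continuous_of_eqOn fun e => ?_
  by_cases h : e = e'
  · subst h
    exact ⟨_, by fun_prop, fun t ht => bubble_edgePt e ht (Ioo_subset_Icc_self hs)⟩
  · exact ⟨0, continuous_zero, fun t _ => bubble_edgePt_of_ne h t s⟩

theorem continuous_bubble_self : Continuous fun x : G.Point => bubble x x :=
  G.continuous_of_eqOn fun e => ⟨_, by fun_prop, fun _ ht => bubble_edgePt e ht ht⟩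

/-- The bound does not involve r: its right side equals 2(s - t)(L - (s - t))/L for t ≤ s, so the
edge Green's functions are equicontinuous in one variable. -/
theorem abs_min_sub_le {L t s r : ℝ} (ht : t ∈ Icc 0 L) (hs : s ∈ Icc 0 L) (hr : r ∈ Icc 0 L)
    (hL : 0 < L) :
    |(min t r - t * r / L) - (min s r - s * r / L)| ≤
      2 * ((min t t - t * t / L) + (min s s - s * s / L) - 2 * (min t s - t * s / L)) := by
  wlog hts : t ≤ s generalizing t s
  · rw [abs_sub_comm]
    refine (this hs ht (le_of_not_ge hts)).trans_eq ?_
    rw [min_comm s t]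
    ring
  obtain ⟨t0, tL⟩ := ht
  obtain ⟨s0, sL⟩ := hs
  obtain ⟨r0, rL⟩ := hr
  rw [min_self, min_self, min_eq_left hts]
  have e1 : 2 * ((t - t * t / L) + (s - s * s / L) - 2 * (t - t * s / L)) =
      2 * (s - t) * (L - (s - t)) / L := by
    field_simp
    ring
  have e2 : (min t r - t * r / L) - (min s r - s * r / L) =
      ((min t r - min s r) * L + (s - t) * r) / L := by
    field_simp
    ring
  rw [e1, e2, abs_div, abs_of_pos hL]
  refine div_le_div_of_nonneg_right ?_ hL.le
  rw [abs_le]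
  rcases le_total r t with h1 | h1
  · rw [min_eq_right h1, min_eq_right (h1.trans hts)]
    constructor <;> nlinarith
  · rcases le_total r s with h2 | h2
    · rw [min_eq_left h1, min_eq_right h2]
      constructor <;> nlinarith [mul_nonneg (sub_nonneg.2 hts) (sub_nonneg.2 h1)]
    · rw [min_eq_left h1, min_eq_left h2]
      constructor <;> nlinarith

/-- Equicontinuity uniform in y: the right side is independent of y and vanishes at x = x', so joint
continuity follows from separate continuity. If x and x' do not lie in one open edge, then bubble x
x' = 0 and at least one of the two terms on the left vanishes. -/
theorem abs_bubble_sub_le (x x' y : G.Point) :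
    |bubble x y - bubble x' y| ≤ 2 * (bubble x x + bubble x' x' - 2 * bubble x x') := by
  -- Comparison with the endpoint 0, where the edge Green's function vanishes.
  have hself : ∀ e, ∀ t ∈ Icc 0 (G.len e), ∀ s ∈ Icc 0 (G.len e),
      |min t s - t * s / G.len e| ≤ 2 * (min t t - t * t / G.len e) := fun e t ht s hs => by
    have h0 : (0 : ℝ) ∈ Icc 0 (G.len e) := ⟨le_rfl, (G.len_pos e).le⟩
    simpa [min_eq_left hs.1, min_eq_right ht.1] using abs_min_sub_le ht h0 hs (G.len_pos e)
  have hone : ∀ x y : G.Point, |bubble x y| ≤ 2 * bubble x x := by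
    intro x y
    rcases exists_eq_edgePt x with ⟨v, rfl⟩ | ⟨e, t, ht, rfl⟩
    · simp
    have ht' := Ioo_subset_Icc_self ht
    rw [bubble_edgePt e ht' ht']
    have hpos := (abs_nonneg _).trans (hself e t ht' t ht')
    rcases exists_eq_edgePt y with ⟨v, rfl⟩ | ⟨e', s, hs, rfl⟩
    · simpa using hpos
    by_cases h : e = e'
    · subst h
      rw [bubble_edgePt e ht' (Ioo_subset_Icc_self hs)]
      exact hself e t ht' s (Ioo_subset_Icc_self hs)
    · rw [bubble_edgePt_of_ne h]
      simpa using hpos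
  have hdisj : bubble x x' = 0 → (bubble x y = 0 ∨ bubble x' y = 0) →
      |bubble x y - bubble x' y| ≤ 2 * (bubble x x + bubble x' x' - 2 * bubble x x') := by
    intro h0 h
    rw [h0]
    have a1 := hone x y
    have a2 := hone x' y
    have b1 := (abs_nonneg _).trans a1
    have b2 := (abs_nonneg _).trans a2
    rcases h with h | h <;> rw [h]
    · rw [zero_sub, abs_neg]
      linarith
    · rw [sub_zero]
      linarith
  rcases exists_eq_edgePt x with ⟨v, rfl⟩ | ⟨e, t, ht, rfl⟩
  · exact hdisj (by simp) (by simp)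
  rcases exists_eq_edgePt x' with ⟨v, rfl⟩ | ⟨e', s, hs, rfl⟩
  · exact hdisj (by simp) (by simp)
  by_cases h : e = e'
  · subst h
    have ht' := Ioo_subset_Icc_self ht
    have hs' := Ioo_subset_Icc_self hs
    rw [bubble_edgePt e ht' ht', bubble_edgePt e hs' hs', bubble_edgePt e ht' hs']
    have h0 : (0 : ℝ) ∈ Icc 0 (G.len e) := ⟨le_rfl, (G.len_pos e).le⟩
    have hnn := (abs_nonneg _).trans (abs_min_sub_le ht' hs' h0 (G.len_pos e))
    rcases exists_eq_edgePt y with ⟨v, rfl⟩ | ⟨e'', r, hr, rfl⟩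
    · simpa using hnn
    by_cases h' : e = e''
    · subst h'
      have hr' := Ioo_subset_Icc_self hr
      rw [bubble_edgePt e ht' hr', bubble_edgePt e hs' hr']
      exact abs_min_sub_le ht' hs' hr' (G.len_pos e)
    · rw [bubble_edgePt_of_ne h', bubble_edgePt_of_ne h']
      simpa using hnn
  · refine hdisj (bubble_edgePt_of_ne h t s) ?_
    rcases exists_eq_edgePt y with ⟨v, rfl⟩ | ⟨e'', r, hr, rfl⟩
    · simp
    by_cases h' : e = e''
    · exact Or.inr (bubble_edgePt_of_ne (fun h'' => h (h'.trans h''.symm)) s r)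
    · exact Or.inl (bubble_edgePt_of_ne h' t r)

theorem continuous_bubble : Continuous fun z : G.Point × G.Point => bubble z.1 z.2 := by
  rw [continuous_iff_continuousAt]
  rintro ⟨x₀, y₀⟩
  have hR : Continuous fun z : G.Point × G.Point =>
      2 * (bubble z.1 z.1 + bubble x₀ x₀ - 2 * bubble z.1 x₀) + |bubble z.2 x₀ - bubble y₀ x₀| := by
    have h1 := continuous_bubble_self (G := G).comp (continuous_fst (X := G.Point) (Y := G.Point))
    have h2 := (continuous_bubble_left x₀).comp (continuous_fst (X := G.Point) (Y := G.Point))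
    have h3 := (continuous_bubble_left x₀).comp (continuous_snd (X := G.Point) (Y := G.Point))
    simp only [Function.comp_def] at h1 h2 h3
    fun_prop
  rw [ContinuousAt, tendsto_iff_dist_tendsto_zero]
  refine squeeze_zero (fun _ => dist_nonneg) (fun z => ?_) (hR.tendsto' (x₀, y₀) 0 (by simp; ring))
  rw [Real.dist_eq, ← sub_add_sub_cancel _ (bubble x₀ z.2)]
  refine (abs_add_le _ _).trans (add_le_add (abs_bubble_sub_le z.1 x₀ z.2) ?_)
  rw [bubble_comm x₀ z.2, bubble_comm x₀ y₀]

end WeightedGraph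
namespace WeightedGraph

variable {V E : Type*} [Fintype V] [Fintype E] {G : WeightedGraph V E}

/-! ### The fundamental kernel -/

theorem hasLaplacian_interp (c : V → ℝ) : G.HasLaplacian (interp c)
    (∑ e, ((c (G.tgt e) - c (G.src e)) / G.len e) •
      (G.pointMass (.vertex (G.tgt e)) - G.pointMass (.vertex (G.src e)))) := by
  refine ⟨fun e => (c (G.tgt e) - c (G.src e)) / G.len e, 0, 0, ⟨by simp, fun e t ht => ?_⟩, ?_⟩
  · rw [interp_edgePt c ht]
    simp only [interp, Pi.zero_apply, kinkSum_zero]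
    ring
  · rw [← Finset.sum_neg_distrib]
    refine Finset.sum_congr rfl fun e _ => ?_
    simp only [quadraticMeasure, Pi.zero_apply, Finsupp.sum_zero_index]
    module

theorem hasLaplacian_bubble (e : E) {s : ℝ} (hs : s ∈ Ioo 0 (G.len e)) :
    G.HasLaplacian (fun x => bubble x (G.edgePt e s))
      (G.pointMass (G.edgePt e s) - (1 - s / G.len e) • G.pointMass (.vertex (G.src e))
        - (s / G.len e) • G.pointMass (.vertex (G.tgt e))) := by
  classical
  refine ⟨fun e' => if e' = e then 1 - s / G.len e else 0, 0,
    fun e' => if e' = e then Finsupp.single s (-1) else 0, ⟨fun e' p hp => ?_,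
    fun e' t ht => ?_⟩, ?_⟩
  · by_cases h : e' = e
    · subst h
      rw [if_pos rfl, Finsupp.single_apply_ne_zero] at hp
      exact hp.1 ▸ hs
    · simp [h] at hp
  · by_cases h : e' = e
    · subst h
      rw [bubble_edgePt e' ht (Ioo_subset_Icc_self hs)]
      simp only [if_true, kinkSum_single, bubble_vertex_left, Pi.zero_apply]
      rcases le_total t s with h | h
      · rw [min_eq_left h, max_eq_right (sub_nonpos.2 h)]
        ring
      · rw [min_eq_right h, max_eq_left (sub_nonneg.2 h)]
        ring
    · simp [h, bubble_edgePt_of_ne h]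
  · rw [Finset.sum_eq_single e (fun e' _ h => by simp [h, quadraticMeasure]) (by simp)]
    simp only [quadraticMeasure, if_true, Pi.zero_apply]
    rw [Finsupp.sum_single_index rfl, Finsupp.sum_single_index (by simp)]
    module

/-- The fundamental kernel on `Γ`, associated with a potential on the vertices. -/
def kernel (J : V → V → ℝ) (x y : G.Point) : ℝ := interp (fun v => interp (J v) y) x + bubble x y

theorem kernel_comm {J : V → V → ℝ} (hJ : ∀ v w, J v w = J w v) (x y : G.Point) :
    kernel J x y = kernel J y x := by
  rw [kernel, kernel, bubble_comm]
  congr 1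
  cases x <;> cases y <;> simp only [interp]
  · exact hJ _ _
  · simp only [hJ _ (G.src _), hJ _ (G.tgt _)]
  · simp only [hJ _ (G.src _), hJ _ (G.tgt _)]
  · rename_i e _ _ _ e' _ _ _
    rw [hJ (G.src e') (G.src e), hJ (G.src e') (G.tgt e), hJ (G.tgt e') (G.src e),
      hJ (G.tgt e') (G.tgt e)]
    ring

theorem continuous_kernel (J : V → V → ℝ) :
    Continuous fun z : G.Point × G.Point => kernel J z.1 z.2 := by
  classical
  refine Continuous.add ?_ continuous_bubble
  -- Expansion in hat functions separates the two variables.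
  have hrep : ∀ (c : V → ℝ) (x : G.Point), interp c x =
      ∑ v, c v * interp (fun w => if w = v then 1 else 0) x := by
    intro c x
    cases x with
    | vertex w => simp [interp]
    | interior e t h₀ h₁ =>
      simp [interp, Finset.sum_add_distrib, mul_add, mul_sub]
      ring
  simp only [hrep (fun v => interp (J v) _)]
  refine continuous_finsetSum _ fun v _ => Continuous.mul ?_ ?_
  · exact (continuous_interp _).comp continuous_snd
  · exact (continuous_interp _).comp continuous_fst

theorem continuous_kernel_left (J : V → V → ℝ) (y : G.Point) : Continuous fun x => kernel J x y :=
  (continuous_kernel J).comp (continuous_id.prodMk continuous_const)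

theorem interp_sub_eq_energy {z : V} {J : V → V → ℝ} (hJ : G.IsPotential z J) (f : V → ℝ)
    (y : G.Point) : G.energy f (fun v => interp (J v) y) = interp f y - f z := by
  cases y with
  | vertex w =>
    simp only [interp, hJ.symm _ w]
    exact hJ.energy_eq f w
  | interior e s h₀ h₁ =>
    have h1 := hJ.energy_eq f (G.src e)
    have h2 := hJ.energy_eq f (G.tgt e)
    have h3 : G.energy f (fun v => interp (J v) (.interior e s h₀ h₁)) =
        G.energy f (J (G.src e)) + s / G.len e *
          (G.energy f (J (G.tgt e)) - G.energy f (J (G.src e))) := by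
      unfold energy
      rw [← Finset.sum_sub_distrib, Finset.mul_sum, ← Finset.sum_add_distrib]
      refine Finset.sum_congr rfl fun e' _ => ?_
      simp only [interp, hJ.symm _ (G.src e), hJ.symm _ (G.tgt e)]
      ring
    rw [h3, h1, h2]
    simp only [interp]
    ring

namespace IsPotential

variable {z : V} {J : V → V → ℝ}

theorem kernel_base_left (hJ : G.IsPotential z J) (y : G.Point) : kernel J (.vertex z) y = 1 := by
  have : J z = fun _ => 1 := funext hJ.base
  simp [kernel, interp_vertex, this, interp_const]

theorem hasLaplacian_interp (hJ : G.IsPotential z J) (w : V) : G.HasLaplacian (interp (J w))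
    (G.pointMass (.vertex w) - G.pointMass (.vertex z)) := by
  convert WeightedGraph.hasLaplacian_interp (G := G) (J w) using 1
  ext A -
  have h := hJ.energy_eq (fun v => G.pointMass (.vertex v) A) w
  simp only [_root_.sub_apply, _root_.sum_apply, _root_.smul_apply, smul_eq_mul]
  rw [← h, energy]
  exact Finset.sum_congr rfl fun e _ => by ring

/-- For y at position s on e, the interpolated part carries the masses 1 - s/ℓ(e) and s/ℓ(e) at the
ends of e, balanced by -δ_z. The bubble cancels these two masses and puts δ_y in their place. -/
theorem hasLaplacian_kernel (hJ : G.IsPotential z J) (y : G.Point) : G.HasLaplacian (fun x => kernel J x y)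
    (G.pointMass y - G.pointMass (.vertex z)) := by
  rcases exists_eq_edgePt y with ⟨w, rfl⟩ | ⟨e, s, hs, rfl⟩
  · convert hJ.hasLaplacian_interp w using 2 with x
    simp only [kernel, bubble_vertex_right, interp, hJ.symm _ w, add_zero]
  · have h1 := (((hJ.hasLaplacian_interp (G.src e)).smul (1 - s / G.len e)).add
      ((hJ.hasLaplacian_interp (G.tgt e)).smul (s / G.len e))).add (hasLaplacian_bubble e hs)
    convert h1 using 1
    · ext x
      rw [kernel, ← interp_const_mul, ← interp_const_mul, ← interp_add]
      congr 2
      ext v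
      rw [interp_edgePt _ (Ioo_subset_Icc_self hs), hJ.symm v (G.src e), hJ.symm v (G.tgt e)]
      ring
    · module

/-- On an edge the diagonal is quadratic with leading coefficient -(ℓ(e) - R_e)/ℓ(e)². The bubble
has outward slope 1 at both ends, which produces the valence terms. The slopes of the interpolated
part at v add up to -2 energy(1_v, J v), which accounts for 2∑δ_v - 2δ_z. -/
theorem hasLaplacian_kernel_self (hJ : G.IsPotential z J) : G.HasLaplacian (fun x => kernel J x x)
    (∑ e, (2 * (G.len e - (J (G.src e) (G.src e) + J (G.tgt e) (G.tgt e)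
        - 2 * J (G.src e) (G.tgt e))) / G.len e ^ 2) • (G.edgeLebesgue e).toSignedMeasure
      - ∑ e, (G.pointMass (.vertex (G.src e)) + G.pointMass (.vertex (G.tgt e)))
      + (2 : ℝ) • ∑ v, G.pointMass (.vertex v) - (2 : ℝ) • G.pointMass (.vertex z)) := by
  classical
  refine ⟨fun e => 2 * (J (G.src e) (G.tgt e) - J (G.src e) (G.src e)) / G.len e + 1,
    fun e => -(2 * (G.len e - (J (G.src e) (G.src e) + J (G.tgt e) (G.tgt e)
        - 2 * J (G.src e) (G.tgt e))) / G.len e ^ 2), 0, ⟨by simp, fun e t ht => ?_⟩, ?_⟩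
  · have hL := (G.len_pos e).ne'
    simp only [kernel, interp_edgePt _ ht, bubble_edgePt e ht ht, min_self, Pi.zero_apply,
      kinkSum_zero, bubble_vertex_left, interp_vertex, hJ.symm (G.tgt e) (G.src e)]
    field_simp
    ring
  · ext A -
    set F : V → ℝ := fun v => G.pointMass (.vertex v) A with hF
    -- The reproducing identity for J v tested on the indicator of v, weighted by F v and summed
    -- over v.
    have hsum : ∑ e, 2 * ((F (G.tgt e) * (J (G.tgt e) (G.tgt e) - J (G.src e) (G.tgt e))
        - F (G.src e) * (J (G.src e) (G.tgt e) - J (G.src e) (G.src e))) / G.len e) =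
        2 * ∑ v, F v - 2 * F z := by
      have h1 : ∀ v, F v * G.energy (Pi.single v 1) (J v) =
          F v - F v * (Pi.single v 1 : V → ℝ) z := fun v => by
        rw [hJ.energy_eq, Pi.single_eq_same]
        ring
      have h2 := Finset.sum_congr (rfl : (Finset.univ : Finset V) = Finset.univ) fun v _ => h1 v
      rw [Finset.sum_sub_distrib] at h2
      have h3 : ∑ v, F v * (Pi.single v 1 : V → ℝ) z = F z := by
        simp [Pi.single_apply]
      rw [h3] at h2
      rw [← Finset.mul_sum, ← mul_sub, ← h2]
      congr 1
      simp only [energy, Finset.mul_sum]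
      rw [Finset.sum_comm]
      refine Finset.sum_congr rfl fun e _ => ?_
      have h4 : ∀ v, F v * (((Pi.single v 1 : V → ℝ) (G.tgt e) - (Pi.single v 1 : V → ℝ) (G.src e))
          * (J v (G.tgt e) - J v (G.src e)) / G.len e) =
          (if G.tgt e = v then F v * (J v (G.tgt e) - J v (G.src e)) / G.len e else 0)
          - (if G.src e = v then F v * (J v (G.tgt e) - J v (G.src e)) / G.len e else 0) := by
        intro v
        simp only [Pi.single_apply]
        split_ifs <;> ring
      simp only [h4, Finset.sum_sub_distrib, Finset.sum_ite_eq, Finset.mem_univ, if_true,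
        hJ.symm (G.tgt e) (G.src e)]
      ring
    simp only [_root_.sub_apply, _root_.add_apply, _root_.sum_apply, _root_.smul_apply,
      _root_.neg_apply, smul_eq_mul, quadraticMeasure, Pi.zero_apply, Finsupp.sum_zero_index,
      add_zero]
    rw [add_sub_assoc, ← hsum, ← Finset.sum_sub_distrib, ← Finset.sum_add_distrib,
      ← Finset.sum_neg_distrib]
    refine Finset.sum_congr rfl fun e _ => ?_
    have hL := (G.len_pos e).ne'
    simp only [hF]
    field_simp
    ring

/-- Green's second identity. The kernel is affine on edges whose interior misses y, so these
contribute terms of the Dirichlet form. The edge with y in its interior contributes in addition the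
deviation of f(y) from the affine interpolation of f. By the reproducing property, the Dirichlet
form equals the interpolated value at y minus f(z). -/
theorem sub_eq_integral_laplacian (hJ : G.IsPotential z J) {f : G.Point → ℝ} (hf : G.InDomain f) (y : G.Point) :
    f y - f (.vertex z) = ∫ᵛ x, kernel J x y ∂<•G.laplacian f := by
  classical
  obtain ⟨w, b, k, h⟩ := hf.exists_hasExpansion
  rw [h.integral_laplacian (continuous_kernel_left J y), ← Finset.sum_neg_distrib]
  set C : V → ℝ := fun v => interp (J v) y with hC
  set fV : V → ℝ := fun v => f (.vertex v) with hfV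
  have hen : G.energy fV C = interp fV y - fV z := interp_sub_eq_energy hJ fV y
  have hzero : ∀ e, (∀ t, bubble (G.edgePt e t) y = 0) →
      -edgePairing (G.len e) (w e) (b e) (k e) ((fun x => kernel J x y) ∘ G.edgePt e) =
        (fV (G.tgt e) - fV (G.src e)) * (C (G.tgt e) - C (G.src e)) / G.len e := by
    intro e he
    rw [edgePairing_congr (H' := fun t => C (G.src e) + (C (G.tgt e) - C (G.src e)) / G.len e * t
      - 0 * max (0 - t) 0) (G.len_pos e).le (h.expansion e).mem_Ioo, (h.expansion e).edgePairing_eq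
        _ _ _ (left_mem_Icc.2 (G.len_pos e).le)]
    · simp only [Function.comp_apply, edgePt_len, edgePt_zero, hfV]
      ring
    · intro t ht
      rw [Function.comp_apply, kernel, he, interp_edgePt _ ht]
      ring
  rcases exists_eq_edgePt y with ⟨v, hy⟩ | ⟨e, s, hs, hy⟩
  · rw [Finset.sum_congr rfl fun e _ => hzero e fun t => by rw [hy, bubble_vertex_right]]
    rw [energy] at hen
    rw [hen, hy]
    rfl
  · have hs' := Ioo_subset_Icc_self hs
    have hone : -edgePairing (G.len e) (w e) (b e) (k e) ((fun x => kernel J x y) ∘ G.edgePt e) =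
        (fV (G.tgt e) - fV (G.src e)) * (C (G.tgt e) - C (G.src e)) / G.len e
          + (f y - interp fV y) := by
      -- Uses min t s = s - max (s - t) 0 to bring the bubble into the shape required by
      -- `edgePairing_eq`.
      rw [edgePairing_congr (H' := fun t => (C (G.src e) + s) +
        ((C (G.tgt e) - C (G.src e)) / G.len e - s / G.len e) * t
        - 1 * max (s - t) 0) (G.len_pos e).le (h.expansion e).mem_Ioo,
        (h.expansion e).edgePairing_eq _ _ _ hs']
      · simp only [Function.comp_apply, edgePt_len, edgePt_zero, hfV]
        rw [hy, interp_edgePt _ hs']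
        ring
      · intro t ht
        rw [Function.comp_apply, kernel, interp_edgePt _ ht, hy, bubble_edgePt e ht hs', ← hy]
        rcases le_total t s with h | h
        · rw [min_eq_left h, max_eq_left (sub_nonneg.2 h)]
          ring
        · rw [min_eq_right h, max_eq_right (sub_nonpos.2 h)]
          ring
    have hsplit : ∀ e', -edgePairing (G.len e') (w e') (b e') (k e')
        ((fun x => kernel J x y) ∘ G.edgePt e') =
        (fV (G.tgt e') - fV (G.src e')) * (C (G.tgt e') - C (G.src e')) / G.len e'
          + if e = e' then f y - interp fV y else 0 := by
      intro e'
      by_cases h : e = e'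
      · subst h
        rw [hone, if_pos rfl]
      · rw [if_neg h, add_zero, hzero e' fun t => by rw [hy, bubble_edgePt_of_ne (Ne.symm h)]]
    rw [Finset.sum_congr rfl fun e' _ => hsplit e', Finset.sum_add_distrib, Finset.sum_ite_eq,
      if_pos (Finset.mem_univ e)]
    rw [energy] at hen
    rw [hen]
    ring

end IsPotential

end WeightedGraph
namespace WeightedGraph

variable {V E : Type*} [Fintype V] [Fintype E] {G : WeightedGraph V E}

/-! ### Effective resistance and Green's functions in terms of the kernel -/

theorem integral_pointMass_sub {h : G.Point → ℝ} (hc : Continuous h) (p : G.Point)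
    (s : SignedMeasure G.Point) :
    ∫ᵛ x, h x ∂<•(G.pointMass p - s) = h p - ∫ᵛ x, h x ∂<•s := by
  rw [VectorMeasure.integral_sub_vectorMeasure (integrable_of_continuous hc _)
    (integrable_of_continuous hc _), integral_pointMass _ hc]

/-- A difference of kernels shows that the fundamental solution exists; the representation formula
then forces the values of whichever solution was chosen. -/
theorem IsPotential.resistance_eq {z : V} {J : V → V → ℝ} (hJ : G.IsPotential z J)
    (y p : G.Point) : G.resistance y p = kernel J y y - 2 * kernel J y p + kernel J p p := by
  have hex : ∃ f : G.Point → ℝ,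
      G.InDomain f ∧ G.laplacian f = G.pointMass y - G.pointMass p ∧ f p = 0 := by
    have h := ((hJ.hasLaplacian_kernel y).sub (hJ.hasLaplacian_kernel p)).sub
      (HasLaplacian.const (kernel J p y - kernel J p p))
    refine ⟨_, h.inDomain, ?_, sub_self _⟩
    rw [h.laplacian_eq]
    abel
  obtain ⟨h1, h2, h3⟩ : G.InDomain (G.fundamentalSolution p y) ∧
      G.laplacian (G.fundamentalSolution p y) = G.pointMass y - G.pointMass p ∧
      G.fundamentalSolution p y p = 0 :=
    Classical.epsilon_spec hex
  have key : ∀ x, G.fundamentalSolution p y x - G.fundamentalSolution p y (.vertex z) =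
      kernel J y x - kernel J p x := fun x => by
    rw [hJ.sub_eq_integral_laplacian h1, h2,
      integral_pointMass_sub (continuous_kernel_left J x),
      integral_pointMass _ (continuous_kernel_left J x)]
  have hy := key y
  have hp := key p
  rw [h3] at hp
  rw [kernel_comm hJ.symm p y] at hy
  rw [resistance]
  linarith

theorem IsPotential.green_eq {z : V} {J : V → V → ℝ} (hJ : G.IsPotential z J)
    {μ : Measure G.Point} [IsFiniteMeasure μ] {g : G.Point → G.Point → ℝ} (hg : G.IsGreen μ g)
    (x y : G.Point) : g x y = kernel J x y - (∫ p, kernel J p x ∂μ) - (∫ p, kernel J p y ∂μ)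
      + (g (.vertex z) (.vertex z) + 1) := by
  have key : ∀ x y, g x y - g (.vertex z) y = kernel J y x - ∫ p, kernel J p x ∂μ :=
    fun x y => by
      rw [hJ.sub_eq_integral_laplacian (hg.inDomain y), hg.laplacian_eq,
        integral_pointMass_sub (continuous_kernel_left J x), VectorMeasure.integral_toSignedMeasure]
  have h1 := key x y
  have h2 := key y (.vertex z)
  rw [hg.symm y] at h2
  rw [kernel_comm hJ.symm y x] at h1
  rw [hJ.kernel_base_left] at h2
  linarith

/-- A Green's function differs from the kernel by terms a(x) + a(y) + const, which cancel in this
combination. -/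
theorem IsGreen.resistance_eq {μ : Measure G.Point} [IsFiniteMeasure μ]
    {g : G.Point → G.Point → ℝ} (hg : G.IsGreen μ g) (x y : G.Point) :
    G.resistance x y = g x x - 2 * g x y + g y y := by
  obtain ⟨z⟩ := G.nonempty
  obtain ⟨J, hJ⟩ := G.exists_isPotential z
  rw [hJ.resistance_eq, hJ.green_eq hg x x, hJ.green_eq hg x y, hJ.green_eq hg y y]
  ring

/-! ### Divisors -/

theorem evalDiv_add (f h : G.Point → ℝ) (D : G.Point →₀ ℤ) :
    G.evalDiv (fun p => f p + h p) D = G.evalDiv f D + G.evalDiv h D := by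
  simp only [evalDiv, mul_add, Finsupp.sum_add]

theorem evalDiv_sub (f h : G.Point → ℝ) (D : G.Point →₀ ℤ) :
    G.evalDiv (fun p => f p - h p) D = G.evalDiv f D - G.evalDiv h D := by
  simp only [evalDiv, mul_sub, Finsupp.sum_sub]

theorem evalDiv_const_mul (r : ℝ) (f : G.Point → ℝ) (D : G.Point →₀ ℤ) :
    G.evalDiv (fun p => r * f p) D = r * G.evalDiv f D := by
  simp only [evalDiv, Finsupp.mul_sum, mul_left_comm r]

theorem evalDiv_const (a : ℝ) (D : G.Point →₀ ℤ) :
    G.evalDiv (fun _ => a) D = (D.sum fun _ n => n : ℤ) * a := by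
  simp only [evalDiv, Finsupp.sum, Int.cast_sum, Finset.sum_mul]

theorem integral_evalDiv {f : G.Point → G.Point → ℝ} (D : G.Point →₀ ℤ) {μ : Measure G.Point}
    (h : ∀ p, Integrable (f p) μ) :
    ∫ x, G.evalDiv (fun p => f p x) D ∂μ = G.evalDiv (fun p => ∫ x, f p x ∂μ) D := by
  simp only [evalDiv, Finsupp.sum]
  rw [integral_finsetSum _ fun p _ => (h p).const_mul _]
  simp only [integral_const_mul]

theorem HasLaplacian.evalDiv {f : G.Point → G.Point → ℝ} {ν : G.Point → SignedMeasure G.Point}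
    (h : ∀ p, G.HasLaplacian (fun x => f x p) (ν p)) (D : G.Point →₀ ℤ) :
    G.HasLaplacian (fun x => G.evalDiv (f x) D) (D.sum fun p n => (n : ℝ) • ν p) :=
  HasLaplacian.sum _ fun p _ => (h p).smul _

theorem canonicalDivisor_apply (q : G.Point →₀ ℤ) (p : G.Point) :
    G.canonicalDivisor q p = 2 * q p + G.valence p - 2 := rfl

/-- Interior points have valence 2, so v(p) - 2 lives on the vertices, where summing valences counts
edge ends. -/
theorem evalDiv_canonicalDivisor (F : G.Point → ℝ) (q : G.Point →₀ ℤ) :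
    G.evalDiv F (G.canonicalDivisor q) = 2 * G.evalDiv F q
      + (∑ e, (F (.vertex (G.src e)) + F (.vertex (G.tgt e))) - 2 * ∑ v, F (.vertex v)) := by
  classical
  have hinj : Function.Injective (Point.vertex : V → G.Point) := fun a b h => by simpa using h
  set S : Finset G.Point := q.support ∪ Finset.univ.image Point.vertex with hS
  have hsub : (G.canonicalDivisor q).support ⊆ S := by
    rintro (v | ⟨e, t, h₀, h₁⟩) hp
    · simp [hS]
    · refine Finset.mem_union_left _ ?_
      rw [Finsupp.mem_support_iff] at hp ⊢
      simpa [canonicalDivisor_apply, valence] using hp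
  rw [evalDiv, Finsupp.sum_of_support_subset _ hsub _ (by simp)]
  have h1 : ∀ p, ((G.canonicalDivisor q p : ℤ) : ℝ) * F p =
      2 * ((q p : ℝ) * F p) + ((G.valence p : ℝ) - 2) * F p := fun p => by
    rw [canonicalDivisor_apply]
    push_cast
    ring
  have h2 : ∑ p ∈ S, (q p : ℝ) * F p = G.evalDiv F q := by
    rw [evalDiv, Finsupp.sum_of_support_subset _ Finset.subset_union_left _ (by simp)]
  have h3 : ∑ p ∈ S, ((G.valence p : ℝ) - 2) * F p =
      ∑ v, ((G.valence (.vertex v) : ℝ) - 2) * F (.vertex v) := by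
    rw [← Finset.sum_image (f := fun p => ((G.valence p : ℝ) - 2) * F p) (hinj.injOn)]
    refine (Finset.sum_subset Finset.subset_union_right ?_).symm
    rintro (v | ⟨e, t, h₀, h₁⟩) - hp
    · simp at hp
    · simp [valence]
  have h4 : ∀ s : E → V, ∑ v, ((Finset.univ.filter fun e => s e = v).card : ℝ) * F (.vertex v) =
      ∑ e, F (.vertex (s e)) := fun s => by
    simp only [Finset.card_filter, Nat.cast_sum, Finset.sum_mul]
    rw [Finset.sum_comm]
    simp
  have h5 : ∀ v, ((G.valence (.vertex v) : ℝ) - 2) * F (.vertex v) =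
      ((Finset.univ.filter fun e => G.src e = v).card : ℝ) * F (.vertex v)
      + ((Finset.univ.filter fun e => G.tgt e = v).card : ℝ) * F (.vertex v)
      - 2 * F (.vertex v) := fun v => by
    simp only [valence]
    push_cast
    rw [sub_mul, add_mul]
  simp only [h1, Finset.sum_add_distrib, ← Finset.mul_sum, h2, h3, h5, Finset.sum_sub_distrib, h4]

/-- Rank–nullity: by connectedness the kernel of the coboundary is the line of constants. -/
theorem betti_eq : (G.betti : ℤ) = Fintype.card E - Fintype.card V + 1 := by
  obtain ⟨z⟩ := G.nonempty
  have h1 := Submodule.finrank_quotient_add_finrank (LinearMap.range G.coboundary)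
  have h2 := LinearMap.finrank_range_add_finrank_ker G.coboundary
  have h3 : LinearMap.ker G.coboundary = Submodule.span ℝ {fun _ => (1 : ℝ)} := by
    ext c
    rw [LinearMap.mem_ker, Submodule.mem_span_singleton]
    constructor
    · intro h
      refine ⟨c z, funext fun v => ?_⟩
      have := G.eq_of_forall_edge (fun e => sub_eq_zero.1 (congrFun h e)) z v
      simpa using this
    · rintro ⟨a, rfl⟩
      ext e
      simp [coboundary]
  have h4 : Module.finrank ℝ (LinearMap.ker G.coboundary) = 1 := by
    rw [h3]
    exact finrank_span_singleton fun h => one_ne_zero (congrFun h z)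
  rw [Module.finrank_fintype_fun_eq_card] at h1 h2
  rw [betti]
  omega

/-! ### The admissible measure -/

/-- On each edge the mass at the target cancels all the others, by the fundamental theorem of
calculus for the slope. -/
theorem HasLaplacian.apply_univ {f : G.Point → ℝ} {ν : SignedMeasure G.Point}
    (h : G.HasLaplacian f ν) : ν univ = 0 := by
  obtain ⟨b, c, k, -, rfl⟩ := h
  have hp : ∀ p, G.pointMass p univ = 1 := fun p => by
    rw [pointMass, Measure.toSignedMeasure_apply_measurable MeasurableSet.univ]
    simp
  rw [_root_.neg_apply, _root_.sum_apply, neg_eq_zero]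
  refine Finset.sum_eq_zero fun e _ => ?_
  have hl : (G.edgeLebesgue e).toSignedMeasure univ = G.len e := by
    rw [Measure.toSignedMeasure_apply_measurable MeasurableSet.univ, edgeLebesgue,
      measureReal_def, Measure.map_apply (G.continuous_edgePt e).measurable MeasurableSet.univ]
    simp [(G.len_pos e).le]
  simp only [quadraticMeasure, Finsupp.sum, _root_.add_apply, _root_.sub_apply, _root_.sum_apply,
    _root_.smul_apply, smul_eq_mul, hp, hl, mul_one]
  ring

theorem exists_isProbabilityMeasure {s : SignedMeasure G.Point}
    (h0 : ∀ A, MeasurableSet A → 0 ≤ s A) (h1 : s univ = 1) :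
    ∃ (μ : Measure G.Point) (_ : IsProbabilityMeasure μ), μ.toSignedMeasure = s := by
  have hs : 0 ≤[univ] s := by
    rw [VectorMeasure.restrict_le_restrict_iff _ _ MeasurableSet.univ]
    intro A hA _
    exact h0 A hA
  refine ⟨s.toMeasureOfZeroLE univ MeasurableSet.univ hs, ⟨?_⟩,
    s.toMeasureOfZeroLE_toSignedMeasure hs⟩
  rw [SignedMeasure.toMeasureOfZeroLE_apply _ hs MeasurableSet.univ MeasurableSet.univ]
  simp [h1]

theorem pointMass_apply_nonneg (p : G.Point) (A : Set G.Point) : 0 ≤ G.pointMass p A := by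
  rw [pointMass, Measure.toSignedMeasure_apply]
  split_ifs
  · exact measureReal_nonneg
  · exact le_rfl

/-- In the Laplacian of k(x,x) + k(x,K) the valence terms cancel against those of K, leaving 2∑ρ_e
dx + 2∑q(p)δ_p - 2γδ_z. Dividing by 2γ gives Δu = s - δ_z with s nonnegative, and s has mass 1
because a Laplacian has mass 0. Then k(x,y) - u(x) - u(y) + c is the Green's function of s. -/
theorem exists_isAdmissible {q : G.Point →₀ ℤ} (hq : ∀ p, 0 ≤ q p) {γ : ℝ} (hγ : 0 < γ)
    (hdeg : ((G.canonicalDivisor q).sum fun _ n => n : ℤ) = 2 * γ - 2) :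
    ∃ μ, G.IsAdmissible (G.canonicalDivisor q) μ := by
  obtain ⟨z⟩ := G.nonempty
  obtain ⟨J, hJ⟩ := G.exists_isPotential z
  set K := G.canonicalDivisor q with hK
  set ρ : E → ℝ := fun e => (G.len e - (J (G.src e) (G.src e) + J (G.tgt e) (G.tgt e)
        - 2 * J (G.src e) (G.tgt e))) / G.len e ^ 2 with hρ
  have hρ0 : ∀ e, 0 ≤ ρ e := fun e =>
    div_nonneg (sub_nonneg.2 (hJ.resistance_le e)) (sq_nonneg _)
  set s : SignedMeasure G.Point := (1 / γ) • (∑ e, ρ e • (G.edgeLebesgue e).toSignedMeasure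
    + q.sum fun p n => (n : ℝ) • G.pointMass p) with hs
  set u : G.Point → ℝ := fun x => 1 / (2 * γ) * (kernel J x x + G.evalDiv (kernel J x) K) with hu
  have hlap : G.HasLaplacian u (s - G.pointMass (.vertex z)) := by
    convert (hJ.hasLaplacian_kernel_self.add
      (HasLaplacian.evalDiv hJ.hasLaplacian_kernel K)).smul (1 / (2 * γ)) using 1
    ext A -
    have hKF := evalDiv_canonicalDivisor (fun p => G.pointMass p A) q
    have hKz := evalDiv_const (G := G) (G.pointMass (.vertex z) A) K
    have hKs : (K.sum fun p n => (n : ℝ) • (G.pointMass p - G.pointMass (.vertex z))) A =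
        G.evalDiv (fun p => G.pointMass p A) K
          - G.evalDiv (fun _ => G.pointMass (.vertex z) A) K := by
      rw [← evalDiv_sub]
      simp only [Finsupp.sum, evalDiv, _root_.sum_apply, _root_.smul_apply, _root_.sub_apply,
        smul_eq_mul]
    have hqs : (q.sum fun p n => (n : ℝ) • G.pointMass p) A =
        G.evalDiv (fun p => G.pointMass p A) q := by
      simp only [Finsupp.sum, evalDiv, _root_.sum_apply, _root_.smul_apply, smul_eq_mul]
    have hρs : ∀ e, 2 * (G.len e - (J (G.src e) (G.src e) + J (G.tgt e) (G.tgt e)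
        - 2 * J (G.src e) (G.tgt e))) / G.len e ^ 2 = 2 * ρ e := fun e => by
      simp only [hρ, mul_div_assoc]
    simp only [hs, _root_.add_apply, _root_.sub_apply, _root_.smul_apply, smul_eq_mul, hKs, hqs,
      hKz, hρs]
    rw [hKF, hdeg]
    simp only [_root_.sum_apply, _root_.smul_apply, _root_.add_apply, smul_eq_mul, mul_assoc,
      ← Finset.mul_sum]
    field_simp
    ring
  have hs0 : ∀ A, MeasurableSet A → 0 ≤ s A := fun A hA => by
    simp only [hs, _root_.add_apply, _root_.smul_apply, _root_.sum_apply, smul_eq_mul, Finsupp.sum]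
    refine mul_nonneg (by positivity) (add_nonneg (Finset.sum_nonneg fun e _ => ?_)
      (Finset.sum_nonneg fun p _ => ?_))
    · rw [Measure.toSignedMeasure_apply_measurable hA]
      exact mul_nonneg (hρ0 e) measureReal_nonneg
    · exact mul_nonneg (Int.cast_nonneg (hq p)) (pointMass_apply_nonneg p A)
  have hs1 : s univ = 1 := by
    have h := hlap.apply_univ
    rw [_root_.sub_apply, pointMass,
      Measure.toSignedMeasure_apply_measurable MeasurableSet.univ] at h
    simpa [sub_eq_zero] using h
  obtain ⟨μ, hμ, hμs⟩ := exists_isProbabilityMeasure hs0 hs1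
  have hker : ∀ y, ∫ x, kernel J x y ∂μ = u y - u (.vertex z) + 1 := fun y => by
    have hc := continuous_kernel_left J y
    have h := hJ.sub_eq_integral_laplacian hlap.inDomain y
    rw [hlap.laplacian_eq, VectorMeasure.integral_sub_vectorMeasure (integrable_of_continuous hc _)
      (integrable_of_continuous hc _), integral_pointMass _ hc, ← hμs,
      VectorMeasure.integral_toSignedMeasure, hJ.kernel_base_left] at h
    linarith
  have huc : Continuous u := hlap.inDomain.continuous
  -- The constant for which the Green's function has integral zero.
  set c : ℝ := ∫ x, u x ∂μ + u (.vertex z) - 1 with hc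
  -- In g(x,x) + g(x,K) the kernels add up to 2γ u(x), while u(x) is subtracted 2 + (2γ - 2) times;
  -- only constants remain.
  refine ⟨μ, hμ, fun x y => kernel J x y - u x - u y + c,
    (2 * γ - 1) * c - G.evalDiv u K, ⟨?_, ?_, ?_, ?_, ?_⟩, ?_⟩
  · exact (((continuous_kernel J).sub (huc.comp continuous_fst)).sub
      (huc.comp continuous_snd)).add continuous_const
  · intro x y
    rw [kernel_comm hJ.symm x y]
    ring
  · intro y
    exact ((((hJ.hasLaplacian_kernel y).sub hlap).sub (HasLaplacian.const _)).add
      (HasLaplacian.const _)).inDomain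
  · intro y
    rw [((((hJ.hasLaplacian_kernel y).sub hlap).sub (HasLaplacian.const _)).add
      (HasLaplacian.const _)).laplacian_eq, hμs]
    abel
  · intro y
    have hi := integrable_of_continuous (continuous_kernel_left J y) μ
    have hui := integrable_of_continuous huc μ
    have hi1 : Integrable (fun x => kernel J x y - u x) μ := hi.sub hui
    have hi2 : Integrable (fun x => kernel J x y - u x - u y) μ := hi1.sub (integrable_const _)
    rw [integral_add hi2 (integrable_const _), integral_sub hi1 (integrable_const _),
      integral_sub hi hui, hker]
    simp only [integral_const, probReal_univ, one_smul, hc]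
    ring
  · intro x
    have h1 : G.evalDiv (fun y => kernel J x y - u x - u y + c) K =
        G.evalDiv (kernel J x) K - (2 * γ - 2) * u x - G.evalDiv u K + (2 * γ - 2) * c := by
      rw [evalDiv_add, evalDiv_sub, evalDiv_sub, evalDiv_const, evalDiv_const, hdeg]
    rw [h1]
    generalize G.evalDiv u K = W
    simp only [hu]
    field_simp
    ring

end WeightedGraph

/-! ### Degree of the canonical divisor and the numerical relations -/

theorem PMGraph.degree_K {V E : Type*} [Fintype V] [Fintype E] (Γ : PMGraph V E) :
    ((Γ.K.sum fun _ n => n : ℤ) : ℝ) = 2 * (Γ.genus : ℝ) - 2 := by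
  have h := WeightedGraph.evalDiv_canonicalDivisor (G := Γ.toWeightedGraph) (fun _ => 1) Γ.q
  rw [WeightedGraph.evalDiv_const, WeightedGraph.evalDiv_const] at h
  have hb : (Γ.betti : ℝ) = Fintype.card E - Fintype.card V + 1 := by
    exact_mod_cast WeightedGraph.betti_eq (G := Γ.toWeightedGraph)
  rw [PMGraph.K, PMGraph.genus]
  push_cast at h ⊢
  rw [hb]
  simp at h
  linarith

/-- Zhang's invariants in terms of the values of the Green's function at the canonical divisor. -/
theorem PMGraph.exists_green_values {V E : Type*} [Fintype V] [Fintype E] (Γ : PMGraph V E)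
    (hg : 0 < Γ.genus) : ∃ A B : ℝ, A + B = (2 * (Γ.genus : ℝ) - 2) * Γ.tau ∧
      Γ.epsilon = A + (2 * (Γ.genus : ℝ) - 2) * Γ.tau ∧
      Γ.resistanceKK = 2 * (2 * (Γ.genus : ℝ) - 2) * A - 2 * B := by
  obtain ⟨hμ, g, a, hG, ha⟩ : Γ.IsAdmissible Γ.K Γ.mu := Classical.epsilon_spec
    (WeightedGraph.exists_isAdmissible Γ.q_nonneg (Int.cast_pos.2 hg) Γ.degree_K)
  have hdeg := Γ.degree_K
  set d : ℝ := 2 * (Γ.genus : ℝ) - 2 with hd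
  have hr := hG.resistance_eq
  have hdiag : Continuous fun x => g x x :=
    hG.continuous.comp (continuous_id.prodMk continuous_id)
  have hsec : ∀ y, Continuous fun x => g x y := fun y => (hG.inDomain y).continuous
  have hsec' : ∀ y, Continuous fun x => g y x := fun y => by simpa only [hG.symm y] using hsec y
  have hint : ∀ y, ∫ x, g y x ∂Γ.mu = 0 := fun y => by
    simpa only [hG.symm y] using hG.integral_eq y
  have hKint : ∫ x, Γ.evalDiv (fun p => g p x) Γ.K ∂Γ.mu = 0 := by
    rw [WeightedGraph.integral_evalDiv _
      fun p => WeightedGraph.integrable_of_continuous (hsec' p) _]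
    simp only [hint, WeightedGraph.evalDiv_const, mul_zero]
  have hKcont : Continuous fun x => Γ.evalDiv (fun p => g p x) Γ.K := by
    simp only [WeightedGraph.evalDiv, Finsupp.sum]
    exact continuous_finsetSum _ fun p _ => continuous_const.mul (hsec' p)
  -- Integrating the admissibility condition kills g(x,K), since every g(p,·) has integral zero.
  have hdiagint : ∫ x, g x x ∂Γ.mu = a := by
    have h1 : ∀ x, g x x = a - Γ.evalDiv (fun p => g p x) Γ.K := fun x => by
      rw [← ha x]
      simp only [hG.symm _ x]
      ring
    simp only [h1]
    rw [integral_sub (integrable_const _) (WeightedGraph.integrable_of_continuous hKcont _), hKint]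
    simp
  have hdiagi : Integrable (fun x => g x x) Γ.mu := WeightedGraph.integrable_of_continuous hdiag _
  have hKi : Integrable (fun x => Γ.evalDiv (fun p => g p x) Γ.K) Γ.mu :=
    WeightedGraph.integrable_of_continuous hKcont _
  have htau : Γ.tau = a := by
    have h1 : ∀ y, ∫ x, Γ.resistance x y ∂Γ.mu = a + g y y := fun y => by
      simp only [hr]
      have hi := (WeightedGraph.integrable_of_continuous (hsec y) Γ.mu).const_mul 2
      have hi' : Integrable (fun x => g x x - 2 * g x y) Γ.mu := hdiagi.sub hi
      rw [integral_add hi' (integrable_const _), integral_sub hdiagi hi, integral_const_mul,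
        hG.integral_eq, hdiagint]
      simp
    rw [PMGraph.tau]
    simp only [h1]
    rw [integral_add (integrable_const _) hdiagi, hdiagint]
    simp
    ring
  have hrK : ∀ y, Γ.evalDiv (fun x => Γ.resistance x y) Γ.K =
      Γ.evalDiv (fun x => g x x) Γ.K - 2 * Γ.evalDiv (fun x => g x y) Γ.K + d * g y y :=
    fun y => by
      simp only [hr]
      rw [WeightedGraph.evalDiv_add, WeightedGraph.evalDiv_sub, WeightedGraph.evalDiv_const_mul,
        WeightedGraph.evalDiv_const, hdeg]
  -- The first relation is the admissibility condition evaluated at K; the other two expand r by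
  -- bilinearity.
  refine ⟨Γ.evalDiv (fun x => g x x) Γ.K,
    Γ.evalDiv (fun x => Γ.evalDiv (fun y => g x y) Γ.K) Γ.K, ?_, ?_, ?_⟩
  · rw [← WeightedGraph.evalDiv_add]
    simp only [ha]
    rw [WeightedGraph.evalDiv_const, hdeg, htau]
  · rw [PMGraph.epsilon, htau]
    simp only [hrK]
    have hi : Integrable (fun y => Γ.evalDiv (fun x => g x x) Γ.K
        - 2 * Γ.evalDiv (fun x => g x y) Γ.K) Γ.mu := (integrable_const _).sub (hKi.const_mul 2)
    rw [integral_add hi (hdiagi.const_mul d), integral_sub (integrable_const _) (hKi.const_mul 2),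
      integral_const_mul, integral_const_mul, hKint, hdiagint]
    simp
  · have h1 : ∀ x, Γ.evalDiv (fun y => Γ.resistance x y) Γ.K =
        d * g x x - 2 * Γ.evalDiv (fun y => g x y) Γ.K + Γ.evalDiv (fun x => g x x) Γ.K :=
      fun x => by
        simp only [hr]
        rw [WeightedGraph.evalDiv_add, WeightedGraph.evalDiv_sub, WeightedGraph.evalDiv_const_mul,
          WeightedGraph.evalDiv_const, hdeg]
    rw [PMGraph.resistanceKK]
    simp only [h1]
    rw [WeightedGraph.evalDiv_add, WeightedGraph.evalDiv_sub, WeightedGraph.evalDiv_const_mul,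
      WeightedGraph.evalDiv_const_mul, WeightedGraph.evalDiv_const, hdeg]
    ring

end

theorem mainTheorem6 {V E : Type*} [Fintype V] [Fintype E] (Γ : PMGraph V E)
    (hg : 2 ≤ Γ.genus) :
    Γ.tau = (2 * (Γ.genus : ℝ) - 1) / (4 * (Γ.genus : ℝ) * ((Γ.genus : ℝ) - 1)) * Γ.epsilon
        - Γ.resistanceKK / (8 * (Γ.genus : ℝ) * ((Γ.genus : ℝ) - 1)) ∧
      Γ.phi = (5 * (Γ.genus : ℝ) - 2) / (4 * ((Γ.genus : ℝ) - 1)) * Γ.epsilon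
        - 3 / (8 * ((Γ.genus : ℝ) - 1)) * Γ.resistanceKK - (1 / 4) * Γ.totalLength := by
  obtain ⟨A, B, h1, h2, h3⟩ := Γ.exists_green_values (by omega)
  have hg' : (2 : ℝ) ≤ Γ.genus := by exact_mod_cast hg
  have hg0 : (Γ.genus : ℝ) ≠ 0 := by positivity
  have hg1 : (Γ.genus : ℝ) - 1 ≠ 0 := by linarith
  have hτ : Γ.tau = (2 * (Γ.genus : ℝ) - 1) / (4 * (Γ.genus : ℝ) * ((Γ.genus : ℝ) - 1))
      * Γ.epsilon - Γ.resistanceKK / (8 * (Γ.genus : ℝ) * ((Γ.genus : ℝ) - 1)) := by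
    -- Eliminating B and then A leaves r(K,K) = (4g - 2)ε - 8g(g - 1)τ.
    have hB : B = (2 * (Γ.genus : ℝ) - 2) * Γ.tau - A := by linarith
    rw [h2, h3, hB]
    field_simp
    ring
  refine ⟨hτ, ?_⟩
  rw [PMGraph.phi, hτ]
  field_simp
  ring
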